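/- Let $g_{yy}:[0,\infty)\to[0,\infty)$ be a smooth function that is positive on $(0,\infty)$, and equip the half-plane $\mathbb{R}^2_+=\{(x,y):x>0\}$ with the metric $g=dx^2+g_{yy}(x)\,dy^2$. Let $V:[0,\infty)\to[0,\infty)$ be a smooth function such that $V>0$ and $V'>0$ on $(0,\infty)$. Fix constants $r_1>r_2\ge 0$, and if $V(0)=0$, assume $r_2>0$. Let $0<L<\infty$ and let $\alpha=(F_\alpha,G_\alpha):[0,L]\to\overline{\mathbb{R}^2_+}$ be a piecewise smooth curve, parametrized by arc length with respect to $g$, such that $\alpha(t)\in\mathbb{R}^2_+$ for all $t\in[0,L)$, $\alpha(0)=(r_1,0)$ and $F_\alpha(L)=r_2$. Let $\omega:[0,r_1-r_2]\to\overline{\mathbb{R}^2_+}$ be the segment $\omega(t)=(r_1-t,0)$. For a curve $\gamma=(F_\gamma,G_\gamma):[0,\ell]\to\overline{\mathbb{R}^2_+}$ write $V_\gamma=V\circ F_\gamma$, and for a real number $k\ge 0$ and an integer $n\ge 1$ define $$\lambda_{k,n}(\gamma)=\inf_W\ \max_{w\in W\setminus\{0\}}\ \frac{\int_0^{\ell}\left(|w'|^2V_\gamma+\frac{k^2|w|^2}{V_\gamma}\right)dt}{\int_0^{\ell}|w|^2V_\gamma\,dt},$$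 where the infimum is taken over all $n$-dimensional subspaces $W$ of $C_0^\infty(0,\ell)$, the space of smooth real-valued functions on $[0,\ell]$ that vanish at $0$ and $\ell$. If $\alpha\neq\omega$ (that is, unless $L=r_1-r_2$ and $\alpha(t)=\omega(t)$ for all $t\in[0,L]$), then for every real number $k\ge 0$ and every integer $n\ge 1$, $$\lambda_{k,n}(\alpha)<\lambda_{k,n}(\omega).$$ -/

import Mathlib

open Set
open scoped ContDiff

/-- A curve `γ` in the plane is piecewise smooth on `[0, L]`: there is a finite partition
`0 = τ 0 < τ 1 < ⋯ < τ m = L` such that `γ` is `C^∞`, up to the endpoints, on each closed piece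
(so that `γ` is in particular continuous on `[0, L]`). Only values on `[0, L]` matter. -/
def IsPiecewiseSmooth (γ : ℝ → ℝ × ℝ) (L : ℝ) : Prop :=
  ∃ (m : ℕ) (τ : ℕ → ℝ), τ 0 = 0 ∧ τ m = L ∧ (∀ i < m, τ i < τ (i + 1)) ∧
    ∀ i < m, ContDiffOn ℝ ∞ γ (Icc (τ i) (τ (i + 1)))

/-- The length of the tangent vector `u = (u₁, u₂)` at the point `p = (x, y)` with respect to
the metric `dx² + gyy(x) dy²`. -/
noncomputable def metricLength (gyy : ℝ → ℝ) (p u : ℝ × ℝ) : ℝ :=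
  Real.sqrt (u.1 ^ 2 + gyy p.1 * u.2 ^ 2)

/-- The curve `γ` on `[0, L]` has unit speed with respect to `dx² + gyy(x) dy²` at each interior
time at which it has a velocity. For a piecewise smooth curve this leaves out at most the finitely
many corners, and says that `γ` is parametrized by arc length. -/
def IsArcLength (gyy : ℝ → ℝ) (γ : ℝ → ℝ × ℝ) (L : ℝ) : Prop :=
  ∀ t ∈ Ioo 0 L, DifferentiableAt ℝ γ t → metricLength gyy (γ t) (deriv γ t) = 1

/-- The straight segment `t ↦ (r₁ - t, 0)`, used on `[0, r₁ - r₂]`. -/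
def segmentCurve (r₁ : ℝ) : ℝ → ℝ × ℝ := fun t => (r₁ - t, 0)

/-- The space `C₀^∞(0, L)` of real functions that are smooth on `[0, L]`, up to the endpoints, and
vanish at `0` and `L`. A function on `[0, L]` is identified with its extension by zero to `ℝ`, so
that elements are equal exactly when they agree on `[0, L]`. -/
def smoothDirichlet (L : ℝ) : Submodule ℝ (ℝ → ℝ) where
  carrier := {w | ContDiffOn ℝ ∞ w (Icc 0 L) ∧ ∀ t ∉ Ioo 0 L, w t = 0}
  add_mem' := by
    rintro u w ⟨hu, hu0⟩ ⟨hw, hw0⟩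
    exact ⟨hu.add hw, fun t ht => by simp [hu0 t ht, hw0 t ht]⟩
  zero_mem' := ⟨contDiffOn_const, fun _ _ => rfl⟩
  smul_mem' := by
    rintro c w ⟨hw, hw0⟩
    exact ⟨contDiffOn_const.smul hw, fun t ht => by simp [hw0 t ht]⟩

/-- The weighted Rayleigh quotient of `w` for the curve `γ` on `[0, L]`, with `V_γ = V ∘ F_γ`,
where `F_γ` is the first component of `γ`:
`∫ (|w'|² V_γ + k² w² / V_γ) / ∫ w² V_γ`, over `[0, L]`. -/
noncomputable def rayleighQuotient (V : ℝ → ℝ) (γ : ℝ → ℝ × ℝ) (L k : ℝ) (w : ℝ → ℝ) : ℝ :=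
  (∫ t in (0 : ℝ)..L, ((derivWithin w (Icc 0 L) t) ^ 2 * V (γ t).1
      + k ^ 2 * (w t) ^ 2 / V (γ t).1)) /
    ∫ t in (0 : ℝ)..L, (w t) ^ 2 * V (γ t).1

/-- The min-max eigenvalue `λ_{k,n}(γ)`: the infimum, over the `n`-dimensional subspaces `W` of
`C₀^∞(0, L)`, of the maximum of the Rayleigh quotient over the nonzero `w ∈ W`. -/
noncomputable def minMaxEigenvalue (V : ℝ → ℝ) (γ : ℝ → ℝ × ℝ) (L k : ℝ) (n : ℕ) : ℝ :=
  sInf {c : ℝ | ∃ W : Submodule ℝ (ℝ → ℝ), W ≤ smoothDirichlet L ∧ Module.finrank ℝ W = n ∧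
    IsGreatest (rayleighQuotient V γ L k '' {w | w ∈ W ∧ w ≠ 0}) c}

open Filter Topology MeasureTheory

/-! The proof is Sturm oscillation theory in Prüfer coordinates, with the angle `θ` normalized at
the right endpoint, where both curves have first coordinate `r₂`. Since `θ` crosses multiples of `π`
only upwards, `θ 0 ≤ -nπ` says that the solution for `μ` has at least `n` nodal intervals. This is
tied to the min-max values without eigenfunctions. An `n`-dimensional test space with quotients
below `μ` forces `θ 0 ≤ -nπ`, by Picone's inequality (`IsPruferAngle.le_of_subspace`). Conversely,
`θ 0 ≤ -nπ` yields test spaces with quotients below any `μ' > μ`, spanned by smoothed nodal pieces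
(`IsPruferAngle.exists_subspace`).

The geometry enters through one function. Let `f(t) = min (r₁ - F_α(t)) (r₁ - r₂)`, the time at
which the segment reaches the level of `α(t)`. Unit speed makes `f` 1-Lipschitz, hence so is its
running maximum `τ`. If `θ₀` is the angle of the segment for `μ = λ(ω)`, then `ψ = θ₀ ∘ τ` is a
subsolution of the equation for `α`. Where `τ = f` the weights agree, `0 ≤ τ' ≤ 1`, and the field of
`θ₀` is positive because the weight of the segment decreases (`IsPruferAngle.pruferField_pos`).
Where `τ > f`, `ψ` stalls, while the field for `α` is positive because its weight is at least that
of the segment at time `τ`. Comparison from the right endpoint gives `θ 0 ≤ θ₀ 0`, and equality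
would force `τ' = 1` almost everywhere, so `L = r₁ - r₂`; but then `α` is the segment
(`eqOn_segmentCurve`). Hence `θ 0 < θ₀ 0 ≤ -nπ`, and the gap leaves room to lower `μ`. -/

/-! ### The Prüfer equation: existence, dependence on the parameter, crossings, Picone's inequality
-/

/-- The right-hand side of the Prüfer equation for `(v w')' = (k² / v - μ v) w`, where
`w = ρ sin θ` and `v w' = ρ cos θ`. -/
noncomputable def pruferField (k μ v θ : ℝ) : ℝ :=
  Real.cos θ ^ 2 / v + (μ * v - k ^ 2 / v) * Real.sin θ ^ 2

/-- `θ` is a Prüfer angle on `[0, L]` for the weight `v`, normalized to vanish at `L`. -/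
def IsPruferAngle (k μ : ℝ) (v : ℝ → ℝ) (L : ℝ) (θ : ℝ → ℝ) : Prop :=
  θ L = 0 ∧ ∀ t ∈ Icc 0 L, HasDerivAt θ (pruferField k μ (v t) (θ t)) t

/-- The divided difference of `pruferField` in the angle. -/
noncomputable def pruferSlope (k μ v a b : ℝ) : ℝ :=
  (μ * v - k ^ 2 / v - 1 / v) * (Real.sinc (a - b) * Real.sin (a + b))

/-- This is `sin² a - sin² b = sin (a - b) sin (a + b)`. Using `sinc` keeps the slope continuous at
`a = b`, so the difference of two angles obeys a linear equation with continuous coefficient. -/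
lemma pruferField_sub (k μ v a b : ℝ) :
    pruferField k μ v a - pruferField k μ v b = pruferSlope k μ v a b * (a - b) := by
  have h1 : Real.sinc (a - b) * (a - b) = Real.sin (a - b) := by
    by_cases h : a - b = 0
    · simp [h]
    · rw [Real.sinc_of_ne_zero h, div_mul_cancel₀ _ h]
  have h2 : Real.sin (a - b) * Real.sin (a + b) = Real.sin a ^ 2 - Real.sin b ^ 2 := by
    rw [Real.sin_sub, Real.sin_add]
    have ha := Real.sin_sq_add_cos_sq a
    have hb := Real.sin_sq_add_cos_sq b
    linear_combination Real.sin a ^ 2 * hb - Real.sin b ^ 2 * ha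
  have h3 : pruferSlope k μ v a b * (a - b) =
      (μ * v - k ^ 2 / v - 1 / v) * (Real.sin a ^ 2 - Real.sin b ^ 2) := by
    rw [pruferSlope, ← h2, ← h1]; ring
  rw [h3, pruferField, pruferField, Real.cos_sq', Real.cos_sq']
  ring

lemma abs_pruferSlope_le (k μ v a b : ℝ) :
    |pruferSlope k μ v a b| ≤ |μ * v - k ^ 2 / v - 1 / v| := by
  rw [pruferSlope, abs_mul]
  refine mul_le_of_le_one_right (abs_nonneg _) ?_
  rw [abs_mul]
  exact mul_le_one₀ (Real.abs_sinc_le_one _) (abs_nonneg _) (Real.abs_sin_le_one _)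

lemma abs_pruferField_sub_le (k μ v a b : ℝ) :
    |pruferField k μ v a - pruferField k μ v b| ≤ |μ * v - k ^ 2 / v - 1 / v| * |a - b| := by
  rw [pruferField_sub, abs_mul]
  exact mul_le_mul_of_nonneg_right (abs_pruferSlope_le ..) (abs_nonneg _)

lemma abs_pruferField_le (k μ v a : ℝ) :
    |pruferField k μ v a| ≤ |1 / v| + |μ * v - k ^ 2 / v| := by
  have hs : |Real.sin a ^ 2| ≤ 1 := by
    rw [abs_of_nonneg (sq_nonneg _)]; exact Real.sin_sq_le_one a
  have hc : |Real.cos a ^ 2| ≤ 1 := by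
    rw [abs_of_nonneg (sq_nonneg _)]; exact Real.cos_sq_le_one a
  refine (abs_add_le _ _).trans (add_le_add ?_ ?_)
  · rw [div_eq_mul_one_div, abs_mul]
    exact mul_le_of_le_one_left (abs_nonneg _) hc
  · rw [abs_mul]
    exact mul_le_of_le_one_right (abs_nonneg _) hs

lemma pruferField_of_sin_eq_zero {k μ v a : ℝ} (h : Real.sin a = 0) :
    pruferField k μ v a = 1 / v := by
  rw [pruferField, Real.cos_sq', h]; simp

lemma pruferField_sub_param (k μ μ' v a : ℝ) :
    pruferField k μ v a - pruferField k μ' v a = (μ - μ') * (v * Real.sin a ^ 2) := by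
  simp only [pruferField]; ring

lemma exists_bound_Icc {f : ℝ → ℝ} (hf : Continuous f) (a b : ℝ) :
    ∃ C, 0 < C ∧ ∀ t ∈ Icc a b, |f t| ≤ C := by
  obtain ⟨C, hC⟩ := isCompact_Icc.exists_bound_of_continuousOn (hf.continuousOn (s := Icc a b))
  exact ⟨max C 1, by positivity, fun t ht => (hC t ht).trans (le_max_left _ _)⟩

/-- The field is bounded and Lipschitz in the angle, uniformly on compact time intervals, so one
application of Picard–Lindelöf covers all of `[0, L]`. -/
lemma exists_isPruferAngle (k μ : ℝ) {v : ℝ → ℝ} (hv : Continuous v) (hpos : ∀ t, 0 < v t)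
    {L : ℝ} (hL : 0 ≤ L) : ∃ θ, IsPruferAngle k μ v L θ := by
  have hne : ∀ t, v t ≠ 0 := fun t => (hpos t).ne'
  obtain ⟨M, hM0, hM⟩ := exists_bound_Icc
    (f := fun t => |1 / v t| + |μ * v t - k ^ 2 / v t|) (by fun_prop (disch := exact hne _))
    (-1) (L + 1)
  obtain ⟨K, hK0, hK⟩ := exists_bound_Icc
    (f := fun t => μ * v t - k ^ 2 / v t - 1 / v t) (by fun_prop (disch := exact hne _))
    (-1) (L + 1)
  -- The time interval is enlarged by `1` on each side so that derivatives are two-sided at `0` and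
  -- `L`. The radius `M * (L + 1)` is the speed bound times the longest time away from `L`.
  have hPL : IsPicardLindelof (fun t θ => pruferField k μ (v t) θ)
      (tmin := -1) (tmax := L + 1) ⟨L, by constructor <;> linarith⟩ (0 : ℝ)
      (⟨M, hM0.le⟩ * ⟨L + 1, by linarith⟩) 0 ⟨M, hM0.le⟩ ⟨K, hK0.le⟩ := by
    constructor
    · intro t ht
      refine LipschitzWith.lipschitzOnWith (LipschitzWith.of_dist_le_mul fun a b => ?_)
      rw [Real.dist_eq, Real.dist_eq]
      exact (abs_pruferField_sub_le ..).trans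
        (mul_le_mul_of_nonneg_right (hK t ht) (abs_nonneg _))
    · intro θ _
      unfold pruferField
      exact Continuous.continuousOn (by fun_prop (disch := exact hne _))
    · intro t ht θ _
      exact (abs_pruferField_le ..).trans ((le_abs_self _).trans (hM t ht))
    · have : max (L + 1 - L) (L - -1) = L + 1 := by
        rw [max_eq_right] <;> linarith
      simp only [this, NNReal.coe_zero, sub_zero]
      exact le_rfl
  obtain ⟨θ, h0, hd⟩ := hPL.exists_eq_forall_mem_Icc_hasDerivWithinAt₀
  refine ⟨θ, h0, fun t ht => (hd t ?_).hasDerivAt (Icc_mem_nhds ?_ ?_)⟩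
  · constructor <;> linarith [ht.1, ht.2]
  · linarith [ht.1]
  · linarith [ht.2]

lemma IsPruferAngle.continuousOn {k μ : ℝ} {v : ℝ → ℝ} {L : ℝ} {θ : ℝ → ℝ}
    (h : IsPruferAngle k μ v L θ) : ContinuousOn θ (Icc 0 L) :=
  fun t ht => (h.2 t ht).continuousAt.continuousWithinAt

/-- Prüfer angles depend Lipschitz-continuously on the spectral parameter. -/
lemma exists_pruferAngle_param_bound (k μ₀ : ℝ) {v : ℝ → ℝ} (hv : Continuous v)
    (hpos : ∀ t, 0 < v t) {L : ℝ} (hL : 0 ≤ L) {θ₀ : ℝ → ℝ} (h₀ : IsPruferAngle k μ₀ v L θ₀) :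
    ∃ C, 0 < C ∧ ∀ μ θ, IsPruferAngle k μ v L θ → |θ 0 - θ₀ 0| ≤ C * |μ - μ₀| := by
  have hne : ∀ t, v t ≠ 0 := fun t => (hpos t).ne'
  obtain ⟨K, hK0, hK⟩ := exists_bound_Icc
    (f := fun t => μ₀ * v t - k ^ 2 / v t - 1 / v t) (by fun_prop (disch := exact hne _)) 0 L
  obtain ⟨M, hM0, hM⟩ := exists_bound_Icc hv 0 L
  refine ⟨M / K * Real.exp (K * L), by positivity, fun μ θ h => ?_⟩
  have hmem : ∀ {t}, t ∈ Icc 0 L → L - t ∈ Icc 0 L := fun ht => by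
    constructor <;> linarith [ht.1, ht.2]
  -- Time is reversed because Grönwall's inequality runs forwards and the angles agree at `L`.
  have hd : ∀ t ∈ Icc 0 L, HasDerivAt (fun s => θ (L - s) - θ₀ (L - s))
      (-(pruferField k μ (v (L - t)) (θ (L - t)) - pruferField k μ₀ (v (L - t)) (θ₀ (L - t)))) t := by
    intro t ht
    have h1 := (h.2 _ (hmem ht)).comp_const_sub L t
    have h2 := (h₀.2 _ (hmem ht)).comp_const_sub L t
    exact (h1.sub h2).congr_deriv (by ring)
  have key := norm_le_gronwallBound_of_norm_deriv_right_le (δ := 0) (K := K) (ε := |μ - μ₀| * M)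
    (f := fun s => θ (L - s) - θ₀ (L - s)) (a := 0) (b := L)
    (fun t ht => (hd t ht).continuousAt.continuousWithinAt)
    (fun t ht => (hd t (Ico_subset_Icc_self ht)).hasDerivWithinAt)
    (by simp [h.1, h₀.1]) ?_ L ⟨hL, le_rfl⟩
  · rw [gronwallBound_of_K_ne_0 hK0.ne'] at key
    simp only [sub_self, sub_zero, zero_mul, zero_add, Real.norm_eq_abs] at key
    refine key.trans ?_
    have : Real.exp (K * L) - 1 ≤ Real.exp (K * L) := by linarith
    calc |μ - μ₀| * M / K * (Real.exp (K * L) - 1) ≤ |μ - μ₀| * M / K * Real.exp (K * L) :=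
          mul_le_mul_of_nonneg_left this (by positivity)
      _ = _ := by ring
  · intro t ht
    have ht' := hmem (Ico_subset_Icc_self ht)
    rw [norm_neg, Real.norm_eq_abs, Real.norm_eq_abs]
    have e : pruferField k μ (v (L - t)) (θ (L - t)) - pruferField k μ₀ (v (L - t)) (θ₀ (L - t)) =
        (pruferField k μ₀ (v (L - t)) (θ (L - t)) - pruferField k μ₀ (v (L - t)) (θ₀ (L - t))) +
        (μ - μ₀) * (v (L - t) * Real.sin (θ (L - t)) ^ 2) := by
      rw [← pruferField_sub_param k]; ring
    rw [e]
    refine (abs_add_le _ _).trans (add_le_add ?_ ?_)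
    · exact (abs_pruferField_sub_le ..).trans
        (mul_le_mul_of_nonneg_right (hK _ ht') (abs_nonneg _))
    · rw [abs_mul, abs_mul]
      refine mul_le_mul_of_nonneg_left ?_ (abs_nonneg _)
      refine (mul_le_of_le_one_right (abs_nonneg _) ?_).trans (hM _ ht')
      rw [abs_of_nonneg (sq_nonneg _)]; exact Real.sin_sq_le_one _

/-- A Prüfer angle crosses the multiples of `π` only upwards. -/
lemma IsPruferAngle.lt_of_le {k μ : ℝ} {v : ℝ → ℝ} (hpos : ∀ t, 0 < v t) {L : ℝ} {θ : ℝ → ℝ}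
    (h : IsPruferAngle k μ v L θ) (j : ℤ) {s t : ℝ} (hs : 0 ≤ s) (hst : s < t) (ht : t ≤ L)
    (hj : j * Real.pi ≤ θ s) : j * Real.pi < θ t := by
  have hd : ∀ x ∈ Icc s t, HasDerivAt θ (pruferField k μ (v x) (θ x)) x := fun x hx =>
    h.2 x ⟨hs.trans hx.1, hx.2.trans ht⟩
  -- The level `jπ` is a barrier: the slope of `θ` there is `1 / v > 0`, whatever `k` and `μ` are.
  have hle : ∀ ⦃x⦄, x ∈ Icc s t → j * Real.pi ≤ θ x := by
    refine image_le_of_deriv_right_lt_deriv_boundary' (f' := fun _ => 0) continuousOn_const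
      (fun x _ => hasDerivWithinAt_const ..) hj
      (fun x hx => (hd x hx).continuousAt.continuousWithinAt)
      (fun x hx => (hd x (Ico_subset_Icc_self hx)).hasDerivWithinAt) fun x _ hx => ?_
    rw [pruferField_of_sin_eq_zero (by rw [← hx]; exact Real.sin_int_mul_pi j)]
    exact one_div_pos.2 (hpos x)
  refine lt_of_le_of_ne (hle ⟨hst.le, le_rfl⟩) fun heq => ?_
  have hd' := hd t ⟨hst.le, le_rfl⟩
  rw [pruferField_of_sin_eq_zero (by rw [← heq]; exact Real.sin_int_mul_pi j)] at hd'
  -- If `θ t = jπ`, the positive slope would put `θ` below `jπ` just before `t`.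
  have hev : ∀ᶠ x in 𝓝[<] t, 0 < slope θ t x :=
    ((hasDerivAt_iff_tendsto_slope.1 hd').mono_left
      (nhdsWithin_mono _ fun x hx => ne_of_lt hx)).eventually (lt_mem_nhds (one_div_pos.2 (hpos t)))
  obtain ⟨x, hx1, hx2⟩ := (hev.and (Ioo_mem_nhdsLT hst)).exists
  have := hle (Ioo_subset_Icc_self hx2)
  rw [slope_def_field] at hx1
  have h3 : θ x - θ t < 0 := by
    by_contra hc
    exact absurd hx1 (not_lt.2 (div_nonpos_of_nonneg_of_nonpos (not_lt.1 hc) (by linarith [hx2.2])))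
  linarith

/-- Picone's inequality: a function that vanishes wherever the solution with Prüfer angle `θ` does
has nonnegative energy. -/
lemma IsPruferAngle.picone {k μ : ℝ} {v : ℝ → ℝ} (hv : Continuous v) (hpos : ∀ t, 0 < v t) {L : ℝ}
    (hL : 0 < L) {θ : ℝ → ℝ} (h : IsPruferAngle k μ v L θ) {w w' : ℝ → ℝ}
    (hw : ∀ t ∈ Icc 0 L, HasDerivWithinAt w (w' t) (Icc 0 L) t) (hw' : ContinuousOn w' (Icc 0 L))
    (h0 : w 0 = 0) (hwL : w L = 0) (hz : ∀ t ∈ Icc 0 L, Real.sin (θ t) = 0 → w t = 0) :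
    0 ≤ ∫ t in (0 : ℝ)..L, (w' t ^ 2 * v t + (k ^ 2 / v t - μ * v t) * w t ^ 2) := by
  have hne : ∀ t, v t ≠ 0 := fun t => (hpos t).ne'
  have hwc : ContinuousOn w (Icc 0 L) := fun t ht => (hw t ht).continuousWithinAt
  -- With `u` the solution, this is `w² v u' / u`, the function in Picone's identity.
  set g : ℝ → ℝ := fun t => w t ^ 2 * Real.cos (θ t) / Real.sin (θ t) with hg
  have key : ∀ t ∈ Icc 0 L, ∃ g', HasDerivWithinAt g g' (Icc 0 L) t ∧
      g' ≤ w' t ^ 2 * v t + (k ^ 2 / v t - μ * v t) * w t ^ 2 := by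
    intro t ht
    have hsin := (h.2 t ht).sin.hasDerivWithinAt (s := Icc 0 L)
    have hcos := (h.2 t ht).cos.hasDerivWithinAt (s := Icc 0 L)
    -- At a node, division by zero gives `g = 0`, which is the correct limit: `w²` vanishes to
    -- second order and `sin θ` only to first.
    by_cases hs : Real.sin (θ t) = 0
    · have hwt := hz t ht hs
      have hc2 : Real.cos (θ t) ^ 2 = 1 := by rw [Real.cos_sq', hs]; simp
      have hc : Real.cos (θ t) ≠ 0 := fun hc => by simp [hc] at hc2
      refine ⟨w' t ^ 2 * v t, ?_, by simp [hwt]⟩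
      rw [hasDerivWithinAt_iff_tendsto_slope] at hsin ⊢
      have hwl := hasDerivWithinAt_iff_tendsto_slope.1 (hw t ht)
      rw [pruferField_of_sin_eq_zero hs] at hsin
      have hcl : Tendsto (fun x => Real.cos (θ x)) (𝓝[Icc 0 L \ {t}] t) (𝓝 (Real.cos (θ t))) :=
        hcos.continuousWithinAt.mono sdiff_subset
      have hlim := ((hwl.pow 2).mul hcl).div hsin
        (mul_ne_zero hc (one_div_ne_zero (hne t)))
      refine (hlim.congr' ?_).trans (le_of_eq ?_)
      · filter_upwards [self_mem_nhdsWithin] with x hx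
        have hxt : x - t ≠ 0 := sub_ne_zero.2 hx.2
        simp only [slope_def_field, hg, hs, hwt, sub_zero]
        by_cases hsx : Real.sin (θ x) = 0
        · simp [hsx, slope_def_field, hs, hz x hx.1 hsx]
        · simp only [Pi.div_apply, slope_def_field, hs, sub_zero]
          field_simp
          simp
      · congr 1
        field_simp
    · have hd := (((hw t ht).pow 2).mul hcos).div hsin hs
      refine ⟨_, hd, ?_⟩
      rw [pruferField]
      have hvt := hpos t
      rw [← sub_nonneg]
      -- The defect in Picone's inequality is exactly this square.
      have : 0 ≤ v t * (w' t - w t * Real.cos (θ t) / (Real.sin (θ t) * v t)) ^ 2 := by positivity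
      refine this.trans (le_of_eq ?_)
      have hs2 := Real.cos_sq' (θ t)
      simp only [Pi.pow_apply, Pi.mul_apply]
      field_simp
      norm_num
      generalize Real.cos (θ t) = c at *
      generalize Real.sin (θ t) = s at *
      linear_combination (-(w t ^ 2 * (c ^ 2 + s ^ 2 * (v t ^ 2 * μ - k ^ 2)))) * hs2
  choose! g' hg' hle using key
  have hgc : ContinuousOn g (Icc 0 L) := fun t ht => (hg' t ht).continuousWithinAt
  have := intervalIntegral.sub_le_integral_of_hasDeriv_right_of_le (g := g) (g' := g') hL.le hgc
    (fun x hx => ((hg' x (Ioo_subset_Icc_self hx)).hasDerivAt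
      (Icc_mem_nhds hx.1 hx.2)).hasDerivWithinAt)
    (ContinuousOn.integrableOn_Icc (((hw'.pow 2).mul hv.continuousOn).add
      (Continuous.continuousOn (by fun_prop (disch := exact hne _)) |>.mul (hwc.pow 2))))
    (fun x hx => hle x (Ioo_subset_Icc_self hx))
  simpa [hg, h0, hwL] using this

/-! ### Quadratic forms, Rayleigh quotients and test spaces -/

/-- The numerator `∫ (w'² v + k² w² / v)` of the Rayleigh quotient for the weight `v`. -/
noncomputable def weightedEnergy (v : ℝ → ℝ) (L k : ℝ) (w : ℝ → ℝ) : ℝ :=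
  ∫ t in (0 : ℝ)..L, ((derivWithin w (Icc 0 L) t) ^ 2 * v t + k ^ 2 * (w t) ^ 2 / v t)

/-- The denominator `∫ w² v` of the Rayleigh quotient for the weight `v`. -/
noncomputable def weightedMass (v : ℝ → ℝ) (L : ℝ) (w : ℝ → ℝ) : ℝ :=
  ∫ t in (0 : ℝ)..L, (w t) ^ 2 * v t

/-- The maxima of the Rayleigh quotient for the weight `v` over the `n`-dimensional spaces of test
functions. -/
def minMaxSet (v : ℝ → ℝ) (L k : ℝ) (n : ℕ) : Set ℝ :=
  {c : ℝ | ∃ W : Submodule ℝ (ℝ → ℝ), W ≤ smoothDirichlet L ∧ Module.finrank ℝ W = n ∧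
    IsGreatest ((fun w => weightedEnergy v L k w / weightedMass v L w) '' {w | w ∈ W ∧ w ≠ 0}) c}

/-- Only the weight on `[0, L]` matters, so it may be replaced by one that is continuous and
positive on the whole line. -/
lemma minMaxEigenvalue_eq (V : ℝ → ℝ) (γ : ℝ → ℝ × ℝ) {L : ℝ} (hL : 0 ≤ L) (k : ℝ) (n : ℕ)
    {v : ℝ → ℝ} (hv : ∀ t ∈ Icc 0 L, V (γ t).1 = v t) :
    minMaxEigenvalue V γ L k n = sInf (minMaxSet v L k n) := by
  have : rayleighQuotient V γ L k = fun w => weightedEnergy v L k w / weightedMass v L w := by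
    funext w
    unfold rayleighQuotient weightedEnergy weightedMass
    congr 1 <;> refine intervalIntegral.integral_congr fun t ht => ?_ <;>
      rw [uIcc_of_le hL] at ht <;> simp only [hv t ht]
  rw [minMaxEigenvalue, minMaxSet, this]

section smoothDirichlet

variable {L : ℝ} {w : ℝ → ℝ}

lemma hasDerivWithinAt_of_mem_smoothDirichlet (hw : w ∈ smoothDirichlet L) {t : ℝ}
    (ht : t ∈ Icc 0 L) : HasDerivWithinAt w (derivWithin w (Icc 0 L) t) (Icc 0 L) t :=
  (hw.1.differentiableOn (by simp) t ht).hasDerivWithinAt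

lemma continuousOn_derivWithin_of_mem_smoothDirichlet (hL : 0 < L) (hw : w ∈ smoothDirichlet L) :
    ContinuousOn (derivWithin w (Icc 0 L)) (Icc 0 L) :=
  hw.1.continuousOn_derivWithin (uniqueDiffOn_Icc hL) (by simp)

lemma continuousOn_of_mem_smoothDirichlet (hw : w ∈ smoothDirichlet L) :
    ContinuousOn w (Icc 0 L) := hw.1.continuousOn

lemma indicator_eq_on_Icc {s : ℝ → ℝ} (h0 : s 0 = 0) (h1 : s L = 0) :
    EqOn ((Ioo 0 L).indicator s) s (Icc 0 L) := fun t ht => by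
  by_cases htm : t ∈ Ioo 0 L
  · exact indicator_of_mem htm s
  · have : t = 0 ∨ t = L := by
      by_contra! h
      exact htm ⟨lt_of_le_of_ne ht.1 h.1.symm, lt_of_le_of_ne ht.2 h.2⟩
    rw [indicator_of_notMem htm]
    rcases this with rfl | rfl
    exacts [h0.symm, h1.symm]

lemma indicator_mem_smoothDirichlet {s : ℝ → ℝ} (hs : ContDiff ℝ ∞ s) (h0 : s 0 = 0)
    (h1 : s L = 0) : (Ioo 0 L).indicator s ∈ smoothDirichlet L :=
  ⟨hs.contDiffOn.congr (indicator_eq_on_Icc h0 h1), fun _ ht => indicator_of_notMem ht s⟩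

lemma derivWithin_indicator {s : ℝ → ℝ} {s' t : ℝ} (hL : 0 < L) (hs : HasDerivAt s s' t)
    (h0 : s 0 = 0) (h1 : s L = 0) (ht : t ∈ Icc 0 L) :
    derivWithin ((Ioo 0 L).indicator s) (Icc 0 L) t = s' :=
  (hs.hasDerivWithinAt.congr (indicator_eq_on_Icc h0 h1)
    (indicator_eq_on_Icc h0 h1 ht)).derivWithin (uniqueDiffOn_Icc hL t ht)

end smoothDirichlet

section forms

variable {L : ℝ} {p q : ℝ → ℝ}

lemma intervalIntegrable_weightedForm (hL : 0 < L) (hp : Continuous p) (hq : Continuous q)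
    {u w : ℝ → ℝ} (hu : u ∈ smoothDirichlet L) (hw : w ∈ smoothDirichlet L) :
    IntervalIntegrable (fun t => derivWithin u (Icc 0 L) t * derivWithin w (Icc 0 L) t * p t +
      u t * w t * q t) volume 0 L := by
  refine ContinuousOn.intervalIntegrable ?_
  rw [uIcc_of_le hL.le]
  exact (((continuousOn_derivWithin_of_mem_smoothDirichlet hL hu).mul
    (continuousOn_derivWithin_of_mem_smoothDirichlet hL hw)).mul hp.continuousOn).add
    (((continuousOn_of_mem_smoothDirichlet hu).mul (continuousOn_of_mem_smoothDirichlet hw)).mul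
      hq.continuousOn)

lemma derivWithin_add_of_mem (hL : 0 < L) {u w : ℝ → ℝ} (hu : u ∈ smoothDirichlet L)
    (hw : w ∈ smoothDirichlet L) {t : ℝ} (ht : t ∈ Icc 0 L) :
    derivWithin (u + w) (Icc 0 L) t =
      derivWithin u (Icc 0 L) t + derivWithin w (Icc 0 L) t :=
  ((hasDerivWithinAt_of_mem_smoothDirichlet hu ht).add
    (hasDerivWithinAt_of_mem_smoothDirichlet hw ht)).derivWithin (uniqueDiffOn_Icc hL t ht)

lemma derivWithin_smul_of_mem (hL : 0 < L) (c : ℝ) {w : ℝ → ℝ}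
    (hw : w ∈ smoothDirichlet L) {t : ℝ} (ht : t ∈ Icc 0 L) :
    derivWithin (c • w) (Icc 0 L) t = c * derivWithin w (Icc 0 L) t :=
  ((hasDerivWithinAt_of_mem_smoothDirichlet hw ht).const_smul c).derivWithin
    (uniqueDiffOn_Icc hL t ht)

/-- The bilinear form `∫ (u' w' p + u w q)` on `C₀^∞(0, L)`. -/
noncomputable def weightedForm (hL : 0 < L) (hp : Continuous p) (hq : Continuous q) :
    smoothDirichlet L →ₗ[ℝ] smoothDirichlet L →ₗ[ℝ] ℝ :=
  LinearMap.mk₂ ℝ (fun u w => ∫ t in (0 : ℝ)..L,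
      (derivWithin (u : ℝ → ℝ) (Icc 0 L) t * derivWithin (w : ℝ → ℝ) (Icc 0 L) t * p t +
        (u : ℝ → ℝ) t * (w : ℝ → ℝ) t * q t))
    (fun u₁ u₂ w => by
      rw [← intervalIntegral.integral_add (intervalIntegrable_weightedForm hL hp hq u₁.2 w.2)
        (intervalIntegrable_weightedForm hL hp hq u₂.2 w.2)]
      refine intervalIntegral.integral_congr fun t ht => ?_
      rw [uIcc_of_le hL.le] at ht
      simp only [Submodule.coe_add, derivWithin_add_of_mem hL u₁.2 u₂.2 ht, Pi.add_apply]
      ring)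
    (fun c u w => by
      rw [← intervalIntegral.integral_smul]
      refine intervalIntegral.integral_congr fun t ht => ?_
      rw [uIcc_of_le hL.le] at ht
      simp only [Submodule.coe_smul, derivWithin_smul_of_mem hL c u.2 ht, Pi.smul_apply,
        smul_eq_mul]
      ring)
    (fun u w₁ w₂ => by
      rw [← intervalIntegral.integral_add (intervalIntegrable_weightedForm hL hp hq u.2 w₁.2)
        (intervalIntegrable_weightedForm hL hp hq u.2 w₂.2)]
      refine intervalIntegral.integral_congr fun t ht => ?_
      rw [uIcc_of_le hL.le] at ht
      simp only [Submodule.coe_add, derivWithin_add_of_mem hL w₁.2 w₂.2 ht, Pi.add_apply]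
      ring)
    (fun c u w => by
      rw [← intervalIntegral.integral_smul]
      refine intervalIntegral.integral_congr fun t ht => ?_
      rw [uIcc_of_le hL.le] at ht
      simp only [Submodule.coe_smul, derivWithin_smul_of_mem hL c w.2 ht, Pi.smul_apply,
        smul_eq_mul]
      ring)

lemma weightedForm_apply (hL : 0 < L) (hp : Continuous p) (hq : Continuous q)
    (u w : smoothDirichlet L) : weightedForm hL hp hq u w = ∫ t in (0 : ℝ)..L,
      (derivWithin (u : ℝ → ℝ) (Icc 0 L) t * derivWithin (w : ℝ → ℝ) (Icc 0 L) t * p t +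
        (u : ℝ → ℝ) t * (w : ℝ → ℝ) t * q t) := rfl

/-- In coefficients the form is a polynomial; this serves both the compactness argument for maxima
and the positivity test for Gram matrices. -/
lemma weightedForm_sum (hL : 0 < L) (hp : Continuous p) (hq : Continuous q) {n : ℕ}
    (b : Fin n → smoothDirichlet L) (c : Fin n → ℝ) :
    weightedForm hL hp hq (∑ i, c i • b i) (∑ i, c i • b i) =
      ∑ i, ∑ j, c i * c j * weightedForm hL hp hq (b i) (b j) := by
  simp only [map_sum, LinearMap.sum_apply, map_smul, LinearMap.smul_apply, smul_eq_mul,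
    Finset.mul_sum]
  rw [Finset.sum_comm]
  refine Finset.sum_congr rfl fun i _ => Finset.sum_congr rfl fun j _ => by ring

end forms

section rayleigh

variable {v : ℝ → ℝ} {L : ℝ} (k : ℝ)

lemma continuous_div_weight (hv : Continuous v) (hpos : ∀ t, 0 < v t) (a : ℝ) :
    Continuous fun t => a / v t := continuous_const.div hv fun t => (hpos t).ne'

lemma weightedEnergy_eq (hL : 0 < L) (hv : Continuous v) (hpos : ∀ t, 0 < v t)
    (w : smoothDirichlet L) : weightedEnergy v L k w =
      weightedForm hL hv (continuous_div_weight hv hpos (k ^ 2)) w w := by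
  rw [weightedForm_apply, weightedEnergy]
  refine intervalIntegral.integral_congr fun t _ => ?_
  ring

lemma weightedMass_eq (hL : 0 < L) (hv : Continuous v) (w : smoothDirichlet L) :
    weightedMass v L w = weightedForm hL (continuous_const (y := (0 : ℝ))) hv w w := by
  rw [weightedForm_apply, weightedMass]
  refine intervalIntegral.integral_congr fun t _ => ?_
  ring

/-- The form `μ * mass - energy` as one weighted form. -/
lemma sub_weightedEnergy_eq (μ : ℝ) (hL : 0 < L) (hv : Continuous v) (hpos : ∀ t, 0 < v t)
    (w : smoothDirichlet L) : μ * weightedMass v L w - weightedEnergy v L k w =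
      weightedForm hL hv.neg ((hv.const_mul μ).sub (continuous_div_weight hv hpos (k ^ 2))) w w := by
  rw [weightedEnergy_eq k hL hv hpos, weightedMass_eq hL hv]
  simp only [weightedForm_apply]
  rw [← intervalIntegral.integral_const_mul, ← intervalIntegral.integral_sub]
  · refine intervalIntegral.integral_congr fun t _ => ?_
    simp only [Pi.neg_apply, Pi.sub_apply]
    ring
  · exact (intervalIntegrable_weightedForm hL continuous_const hv w.2 w.2).const_mul μ
  · exact intervalIntegrable_weightedForm hL hv (continuous_div_weight hv hpos _) w.2 w.2

lemma weightedEnergy_nonneg (hL : 0 ≤ L) (hpos : ∀ t, 0 < v t) (w : ℝ → ℝ) :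
    0 ≤ weightedEnergy v L k w := by
  refine intervalIntegral.integral_nonneg hL fun t _ => ?_
  have := hpos t
  positivity

lemma weightedMass_nonneg (hL : 0 ≤ L) (hpos : ∀ t, 0 < v t) (w : ℝ → ℝ) :
    0 ≤ weightedMass v L w := by
  refine intervalIntegral.integral_nonneg hL fun t _ => ?_
  have := hpos t
  positivity

lemma weightedMass_pos (hL : 0 < L) (hv : Continuous v) (hpos : ∀ t, 0 < v t) {w : ℝ → ℝ}
    (hw : w ∈ smoothDirichlet L) (hne : w ≠ 0) : 0 < weightedMass v L w := by
  obtain ⟨t, ht⟩ := Function.ne_iff.1 hne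
  have htm : t ∈ Ioo 0 L := by
    by_contra h
    exact ht (hw.2 t h)
  refine intervalIntegral.integral_pos hL
    (((continuousOn_of_mem_smoothDirichlet hw).pow 2).mul hv.continuousOn)
    (fun s _ => mul_nonneg (sq_nonneg _) (hpos s).le) ⟨t, Ioo_subset_Icc_self htm, ?_⟩
  have : w t ≠ 0 := ht
  have := hpos t
  positivity

/-- The Rayleigh quotient attains its maximum on a finite-dimensional space of test functions. -/
lemma exists_isGreatest_rayleigh (hL : 0 < L) (hv : Continuous v) (hpos : ∀ t, 0 < v t)
    {W : Submodule ℝ (ℝ → ℝ)} (hW : W ≤ smoothDirichlet L) {n : ℕ} (hn : 1 ≤ n)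
    (hWn : Module.finrank ℝ W = n) :
    ∃ c, IsGreatest ((fun w => weightedEnergy v L k w / weightedMass v L w) ''
      {w | w ∈ W ∧ w ≠ 0}) c := by
  have : FiniteDimensional ℝ W := Module.finite_of_finrank_pos (by omega)
  let b := Module.finBasisOfFinrankEq ℝ W hWn
  let b' : Fin n → smoothDirichlet L := fun i => ⟨b i, hW (b i).2⟩
  let e : (Fin n → ℝ) → smoothDirichlet L := fun c => ∑ i, c i • b' i
  have he : ∀ c, (e c : ℝ → ℝ) = ((b.equivFun.symm c : W) : ℝ → ℝ) := fun c => by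
    simp [e, b', Module.Basis.equivFun_symm_apply]
  have heW : ∀ c, (e c : ℝ → ℝ) ∈ W := fun c => by rw [he]; exact (b.equivFun.symm c).2
  have hene : ∀ c, c ≠ 0 → (e c : ℝ → ℝ) ≠ 0 := fun c hc h => by
    rw [he] at h
    exact hc ((LinearEquiv.map_eq_zero_iff _).1 (Subtype.ext h))
  set R : (Fin n → ℝ) → ℝ := fun c => weightedEnergy v L k (e c) / weightedMass v L (e c) with hR
  have hRc : ContinuousOn R {0}ᶜ := by
    have h1 : ∀ {p q : ℝ → ℝ} (hp : Continuous p) (hq : Continuous q),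
        Continuous fun c => weightedForm hL hp hq (e c) (e c) := fun hp hq => by
      simp only [e, weightedForm_sum]
      fun_prop
    refine ContinuousOn.div ?_ ?_ fun c hc => (weightedMass_pos hL hv hpos (e c).2 (hene c hc)).ne'
    · simp only [weightedEnergy_eq k hL hv hpos]
      exact (h1 _ _).continuousOn
    · simp only [weightedMass_eq hL hv]
      exact (h1 _ _).continuousOn
  -- The quotient is homogeneous of degree zero, so its maximum on the unit sphere of coefficients
  -- is global.
  have hsmul : ∀ (a : ℝ) c, a ≠ 0 → R (a • c) = R c := fun a c ha => by
    have hea : e (a • c) = a • e c := by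
      simp [e, Finset.smul_sum, smul_smul]
    simp only [hR, weightedEnergy_eq k hL hv hpos, weightedMass_eq hL hv, hea, map_smul,
      LinearMap.smul_apply, smul_eq_mul]
    rw [mul_div_mul_left _ _ ha, mul_div_mul_left _ _ ha]
  have : Nonempty (Fin n) := ⟨⟨0, by omega⟩⟩
  have hsph : Metric.sphere (0 : Fin n → ℝ) 1 ⊆ {0}ᶜ := fun c hc h => by
    rw [mem_singleton_iff] at h
    simp [h] at hc
  obtain ⟨c₀, hc₀, hmax⟩ := (isCompact_sphere (0 : Fin n → ℝ) 1).exists_isMaxOn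
    (NormedSpace.sphere_nonempty.2 zero_le_one) (hRc.mono hsph)
  refine ⟨R c₀, ⟨e c₀, ⟨heW _, hene _ (hsph hc₀)⟩, rfl⟩, ?_⟩
  rintro _ ⟨w, ⟨hw, hne⟩, rfl⟩
  set c := b.equivFun ⟨w, hw⟩ with hc
  have hec : (e c : ℝ → ℝ) = w := by rw [he, hc]; simp
  have hc0 : c ≠ 0 := fun h => hne (by rw [← hec, he, h]; simp)
  have hnorm : ‖c‖ ≠ 0 := norm_ne_zero_iff.2 hc0
  have hle := hmax (show ‖c‖⁻¹ • c ∈ Metric.sphere (0 : Fin n → ℝ) 1 by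
    simp [norm_smul, hnorm])
  rw [mem_ofPred_eq, hsmul _ _ (inv_ne_zero hnorm)] at hle
  simpa only [hR, hec] using hle

lemma nonneg_of_mem_minMaxSet (hL : 0 ≤ L) (hpos : ∀ t, 0 < v t) {n : ℕ} {c : ℝ}
    (hc : c ∈ minMaxSet v L k n) : 0 ≤ c := by
  obtain ⟨W, -, -, ⟨w, -, rfl⟩, -⟩ := hc
  exact div_nonneg (weightedEnergy_nonneg k hL hpos w) (weightedMass_nonneg hL hpos w)

lemma exists_subspace_of_mem_minMaxSet (hL : 0 < L) (hv : Continuous v) (hpos : ∀ t, 0 < v t)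
    {n : ℕ} {c μ : ℝ} (hc : c ∈ minMaxSet v L k n) (hμ : c < μ) :
    ∃ W : Submodule ℝ (ℝ → ℝ), W ≤ smoothDirichlet L ∧ Module.finrank ℝ W = n ∧
      ∀ w ∈ W, w ≠ 0 → weightedEnergy v L k w < μ * weightedMass v L w := by
  obtain ⟨W, hW, hWn, -, hub⟩ := hc
  refine ⟨W, hW, hWn, fun w hw hne => ?_⟩
  have hle : weightedEnergy v L k w / weightedMass v L w ≤ c := hub ⟨w, ⟨hw, hne⟩, rfl⟩
  exact (div_lt_iff₀ (weightedMass_pos hL hv hpos (hW hw) hne)).1 (hle.trans_lt hμ)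

/-- Strictness survives because the maximum over `W` is attained. -/
lemma sInf_minMaxSet_lt (hL : 0 < L) (hv : Continuous v) (hpos : ∀ t, 0 < v t)
    {n : ℕ} (hn : 1 ≤ n) {μ : ℝ} {W : Submodule ℝ (ℝ → ℝ)} (hW : W ≤ smoothDirichlet L)
    (hWn : Module.finrank ℝ W = n)
    (hlt : ∀ w ∈ W, w ≠ 0 → weightedEnergy v L k w < μ * weightedMass v L w) :
    sInf (minMaxSet v L k n) < μ := by
  obtain ⟨c, hc⟩ := exists_isGreatest_rayleigh k hL hv hpos hW hn hWn
  refine (csInf_le ⟨0, fun x hx => nonneg_of_mem_minMaxSet k hL.le hpos hx⟩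
    ⟨W, hW, hWn, hc⟩).trans_lt ?_
  obtain ⟨w, ⟨hw, hne⟩, rfl⟩ := hc.1
  exact (div_lt_iff₀ (weightedMass_pos hL hv hpos (hW hw) hne)).2 (hlt w hw hne)

/-- Polynomials times `t (L - t)` provide test spaces of every dimension. -/
lemma exists_subspace_finrank_eq (hL : 0 < L) (n : ℕ) :
    ∃ W : Submodule ℝ (ℝ → ℝ), W ≤ smoothDirichlet L ∧ Module.finrank ℝ W = n := by
  let f : Polynomial ℝ →ₗ[ℝ] (ℝ → ℝ) :=
    { toFun := fun p => (Ioo 0 L).indicator fun t => t * (L - t) * p.eval t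
      map_add' := fun p q => by
        funext t
        by_cases ht : t ∈ Ioo 0 L <;> simp [ht, mul_add]
      map_smul' := fun c p => by
        funext t
        by_cases ht : t ∈ Ioo 0 L
        · simp [ht]
          ring
        · simp [ht] }
  have hf : Function.Injective f := by
    rw [injective_iff_map_eq_zero]
    intro p hp
    refine Polynomial.eq_zero_of_infinite_isRoot p ((Ioo_infinite hL).mono fun t ht => ?_)
    have h1 := congrFun hp t
    change (Ioo 0 L).indicator (fun t => t * (L - t) * p.eval t) t = 0 at h1
    rw [indicator_of_mem ht] at h1
    have h2 : t * (L - t) ≠ 0 := mul_ne_zero ht.1.ne' (sub_ne_zero.2 ht.2.ne')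
    exact (mul_eq_zero.1 h1).resolve_left h2
  refine ⟨(Polynomial.degreeLT ℝ n).map f, ?_, ?_⟩
  · rintro _ ⟨p, -, rfl⟩
    exact indicator_mem_smoothDirichlet
      ((contDiff_id.mul (contDiff_const.sub contDiff_id)).mul (p.contDiff_aeval ∞))
      (by simp) (by simp)
  · rw [← (Submodule.equivMapOfInjective f hf _).finrank_eq, (Polynomial.degreeLTEquiv ℝ n).finrank_eq]
    simp

lemma minMaxSet_nonempty (hL : 0 < L) (hv : Continuous v) (hpos : ∀ t, 0 < v t) {n : ℕ}
    (hn : 1 ≤ n) : (minMaxSet v L k n).Nonempty := by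
  obtain ⟨W, hW, hWn⟩ := exists_subspace_finrank_eq hL n
  obtain ⟨c, hc⟩ := exists_isGreatest_rayleigh k hL hv hpos hW hn hWn
  exact ⟨c, W, hW, hWn, hc⟩

/-! ### From test spaces to nodes -/

/-- If the Rayleigh quotient is below `μ` on an `n`-dimensional space, then the solution for `μ`
has at least `n` nodes: its Prüfer angle has total variation at least `n π`. -/
lemma IsPruferAngle.le_of_subspace {μ : ℝ} (hL : 0 < L) (hv : Continuous v) (hpos : ∀ t, 0 < v t)
    {θ : ℝ → ℝ} (h : IsPruferAngle k μ v L θ) {n : ℕ} {W : Submodule ℝ (ℝ → ℝ)}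
    (hW : W ≤ smoothDirichlet L) (hWn : Module.finrank ℝ W = n)
    (hlt : ∀ w ∈ W, w ≠ 0 → weightedEnergy v L k w < μ * weightedMass v L w) :
    θ 0 ≤ -(n * Real.pi) := by
  by_contra! hcon
  rcases Nat.eq_zero_or_pos n with rfl | hn
  · have := h.lt_of_le hpos 0 le_rfl hL le_rfl (by simpa using hcon.le)
    simp [h.1] at this
  have : FiniteDimensional ℝ W := Module.finite_of_finrank_pos (by omega)
  classical
  -- The interior nodes are the points where `θ` takes the values `-π, …, -(n - 1)π`, each taken at
  -- most once. The default `0` for a level not attained merely adds a harmless condition.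
  let node : Fin (n - 1) → ℝ := fun j =>
    if hj : ∃ t ∈ Icc 0 L, θ t = ((-(j + 1 : ℤ) : ℤ) : ℝ) * Real.pi then hj.choose else 0
  let ev : W →ₗ[ℝ] (Fin (n - 1) → ℝ) :=
    (LinearMap.funLeft ℝ ℝ node).comp W.subtype
  -- Fewer conditions than dimensions: some nonzero `w ∈ W` vanishes at every node, and Picone's
  -- inequality then contradicts the bound on its quotient.
  have hker := LinearMap.ker_ne_bot_of_finrank_lt (f := ev) (by simp [hWn]; omega)
  obtain ⟨⟨w, hwW⟩, hw, hw0⟩ := (Submodule.ne_bot_iff _).1 hker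
  have hne : w ≠ 0 := fun h0 => hw0 (by simpa using h0)
  have hwd := hW hwW
  have hb : ∀ {t}, t ∉ Ioo 0 L → w t = 0 := fun ht => hwd.2 _ ht
  have hz : ∀ t ∈ Icc 0 L, Real.sin (θ t) = 0 → w t = 0 := by
    intro t ht hs
    by_cases htm : t ∈ Ioo 0 L
    swap
    · exact hb htm
    obtain ⟨j, hj⟩ := Real.sin_eq_zero_iff.1 hs
    have hj0 : j < 0 := by
      have := h.lt_of_le hpos j htm.1.le htm.2 le_rfl hj.le
      rw [h.1] at this
      by_contra! hc
      have : (0 : ℝ) ≤ j * Real.pi := mul_nonneg (by exact_mod_cast hc) Real.pi_pos.le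
      linarith
    have hjn : -(n : ℤ) < j := by
      have := h.lt_of_le hpos (-n) le_rfl htm.1 htm.2.le (by push_cast; linarith)
      rw [← hj] at this
      exact_mod_cast lt_of_mul_lt_mul_right this Real.pi_pos.le
    let i : Fin (n - 1) := ⟨(-j - 1).toNat, by omega⟩
    have hi : (-((i : ℕ) + 1 : ℤ) : ℤ) = j := by
      simp only [i]; omega
    have hex : ∃ t ∈ Icc 0 L, θ t = ((-((i : ℕ) + 1 : ℤ) : ℤ) : ℝ) * Real.pi :=
      ⟨t, ht, by rw [hi, hj]⟩
    have hnode : node i = t := by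
      have h1 : node i = hex.choose := dif_pos hex
      obtain ⟨h2, h3⟩ := hex.choose_spec
      rw [← h1] at h2 h3
      rw [hi] at h3
      rcases lt_trichotomy (node i) t with hlt' | heq | hgt
      · exact absurd hj.symm (h.lt_of_le hpos j h2.1 hlt' ht.2 h3.ge).ne'
      · exact heq
      · exact absurd h3 (h.lt_of_le hpos j ht.1 hgt h2.2 hj.le).ne'
    rw [← hnode]
    exact congrFun (LinearMap.mem_ker.1 hw) i
  have hp := h.picone hv hpos hL (fun t ht => hasDerivWithinAt_of_mem_smoothDirichlet hwd ht)
    (continuousOn_derivWithin_of_mem_smoothDirichlet hL hwd) (hb (by simp)) (hb (by simp)) hz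
  have he := sub_weightedEnergy_eq k μ hL hv hpos ⟨w, hwd⟩
  rw [weightedForm_apply] at he
  have heq : (∫ t in (0 : ℝ)..L, (derivWithin w (Icc 0 L) t ^ 2 * v t +
      (k ^ 2 / v t - μ * v t) * w t ^ 2)) = -(μ * weightedMass v L w - weightedEnergy v L k w) := by
    rw [he, ← intervalIntegral.integral_neg]
    refine intervalIntegral.integral_congr fun t _ => ?_
    simp only [Pi.neg_apply, Pi.sub_apply]
    ring
  rw [heq] at hp
  linarith [hlt w hwW hne]

end rayleigh

/-! ### From nodes to test spaces -/

/-- Clamping the argument of `u` to `[a, b]` gives a continuous function equal to the truncation of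
`u`, differentiable off `{a, b}`. -/
lemma integral_indicator_Ioo_deriv {L a b : ℝ} (h0a : 0 ≤ a) (hab : a < b) (hbL : b ≤ L)
    {u φ : ℝ → ℝ} (hu : ∀ t ∈ Icc 0 L, HasDerivAt u (φ t) t) (hφ : ContinuousOn φ (Icc 0 L))
    (ha : u a = 0) (hb : u b = 0) {t : ℝ} (ht : t ∈ Icc 0 L) :
    ∫ s in (0 : ℝ)..t, (Ioo a b).indicator φ s = (Ioo a b).indicator u t := by
  have hclamp : ∀ s, max a (min s b) ∈ Icc 0 L := fun s =>
    ⟨h0a.trans (le_max_left _ _), max_le (hab.le.trans hbL) ((min_le_right _ _).trans hbL)⟩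
  have hU : ∀ s, u (max a (min s b)) = (Ioo a b).indicator u s := fun s => by
    by_cases hs : s ∈ Ioo a b
    · rw [indicator_of_mem hs, min_eq_left hs.2.le, max_eq_right hs.1.le]
    · rw [indicator_of_notMem hs]
      rcases le_or_gt s a with h | h
      · rw [max_eq_left ((min_le_left _ _).trans h), ha]
      · have : b ≤ s := by
          by_contra! hc
          exact hs ⟨h, hc⟩
        rw [min_eq_right this, max_eq_right hab.le, hb]
  have hcont : Continuous fun s => u (max a (min s b)) := by
    have hucont : ContinuousOn u (Icc 0 L) := fun s hs => (hu s hs).continuousAt.continuousWithinAt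
    exact hucont.comp_continuous (by fun_prop) hclamp
  have hd : ∀ s ∉ ({a, b} : Set ℝ),
      HasDerivAt (fun s => u (max a (min s b))) ((Ioo a b).indicator φ s) s := by
    intro s hs
    have hsa : s ≠ a := fun h => hs (by simp [h])
    have hsb : s ≠ b := fun h => hs (by simp [h])
    rcases lt_or_gt_of_ne hsa with h | h
    · rw [indicator_of_notMem (fun hm => lt_asymm h hm.1)]
      refine (hasDerivAt_const s (0 : ℝ)).congr_of_eventuallyEq ?_
      filter_upwards [Iio_mem_nhds h] with x hx
      rw [hU, indicator_of_notMem (fun hm => lt_asymm hx hm.1)]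
    rcases lt_or_gt_of_ne hsb with h' | h'
    · rw [indicator_of_mem (show s ∈ Ioo a b from ⟨h, h'⟩)]
      refine (hu s ⟨h0a.trans h.le, h'.le.trans hbL⟩).congr_of_eventuallyEq ?_
      filter_upwards [Ioo_mem_nhds h h'] with x hx
      rw [hU, indicator_of_mem hx]
    · rw [indicator_of_notMem (fun hm => lt_asymm h' hm.2)]
      refine (hasDerivAt_const s (0 : ℝ)).congr_of_eventuallyEq ?_
      filter_upwards [Ioi_mem_nhds h'] with x hx
      rw [hU, indicator_of_notMem (fun hm => lt_asymm hx hm.2)]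
  have hint : IntervalIntegrable ((Ioo a b).indicator φ) volume 0 t := by
    rw [intervalIntegrable_iff_integrableOn_Icc_of_le ht.1]
    exact ((hφ.mono (Icc_subset_Icc le_rfl ht.2)).integrableOn_Icc).indicator measurableSet_Ioo
  rw [MeasureTheory.integral_eq_of_hasDerivAt_off_countable
    (fun s => u (max a (min s b))) _ (Countable.insert a (countable_singleton b))
    hcont.continuousOn (fun s hs => hd s hs.2) hint]
  rw [hU, hU, indicator_of_notMem (fun hm : (0 : ℝ) ∈ Ioo a b => absurd hm.1 (not_lt.2 h0a)),
    sub_zero]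

/-- A function that is `C¹` on `[a, b]` and vanishes at `a` and `b`, extended by zero, is the limit
of test functions with a uniform bound on the functions and their derivatives. -/
lemma exists_smoothDirichlet_approx {L a b : ℝ} (h0a : 0 ≤ a) (hab : a < b) (hbL : b ≤ L)
    {u φ : ℝ → ℝ} (hu : ∀ t ∈ Icc 0 L, HasDerivAt u (φ t) t) (hφ : ContinuousOn φ (Icc 0 L))
    (ha : u a = 0) (hb : u b = 0) :
    ∃ (w : ℕ → ℝ → ℝ) (C : ℝ), (∀ N, w N ∈ smoothDirichlet L) ∧
      (∀ N, ∀ t ∈ Icc 0 L, |derivWithin (w N) (Icc 0 L) t| ≤ C ∧ |w N t| ≤ C) ∧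
      ∀ t ∈ Icc 0 L, Tendsto (fun N => derivWithin (w N) (Icc 0 L) t) atTop
          (𝓝 ((Ioo a b).indicator φ t)) ∧
        Tendsto (fun N => w N t) atTop (𝓝 ((Ioo a b).indicator u t)) := by
  have hL : 0 < L := by linarith
  obtain ⟨M, hM⟩ := isCompact_Icc.exists_bound_of_continuousOn hφ
  have hM0 : 0 ≤ M := (norm_nonneg _).trans (hM 0 ⟨le_rfl, hL.le⟩)
  choose p hp using fun N : ℕ =>
    exists_polynomial_near_of_continuousOn 0 L φ hφ (1 / ((N : ℝ) + 1)) (by positivity)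
  -- The truncated derivative is approximated by Weierstrass polynomials times smooth cutoffs
  -- tending to the indicator of `(a, b)`; primitives then approximate the truncated `u`.
  let χ : ℕ → ℝ → ℝ := fun N t =>
    Real.smoothTransition (N * (t - a)) * Real.smoothTransition (N * (b - t))
  have hχ0 : ∀ N t, 0 ≤ χ N t := fun N t =>
    mul_nonneg (Real.smoothTransition.nonneg _) (Real.smoothTransition.nonneg _)
  have hχ1 : ∀ N t, χ N t ≤ 1 := fun N t =>
    mul_le_one₀ (Real.smoothTransition.le_one _) (Real.smoothTransition.nonneg _)
      (Real.smoothTransition.le_one _)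
  let g : ℕ → ℝ → ℝ := fun N t => (p N).eval t * χ N t
  have hgs : ∀ N, ContDiff ℝ ∞ (g N) := fun N => by
    have h1 : ContDiff ℝ ∞ fun t => (p N).eval t := (p N).contDiff_aeval ∞
    exact h1.mul ((Real.smoothTransition.contDiff.comp
      (contDiff_const.mul (contDiff_id.sub contDiff_const))).mul
      (Real.smoothTransition.contDiff.comp (contDiff_const.mul (contDiff_const.sub contDiff_id))))
  have hgb : ∀ N, ∀ t ∈ Icc 0 L, |g N t| ≤ M + 1 := fun N t ht => by
    have h1 := hp N t ht
    have h2 := hM t ht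
    rw [Real.norm_eq_abs] at h2
    have h3 : 1 / ((N : ℝ) + 1) ≤ 1 := by
      rw [div_le_one (by positivity)]
      linarith [(Nat.cast_nonneg N : (0 : ℝ) ≤ N)]
    have h4 : |(p N).eval t| ≤ M + 1 := by
      calc |(p N).eval t| = |((p N).eval t - φ t) + φ t| := by ring_nf
        _ ≤ |(p N).eval t - φ t| + |φ t| := abs_add_le _ _
        _ ≤ M + 1 := by linarith
    rw [abs_mul, abs_of_nonneg (hχ0 N t)]
    exact (mul_le_of_le_one_right (abs_nonneg _) (hχ1 N t)).trans h4
  have hglim : ∀ t ∈ Icc 0 L, Tendsto (fun N => g N t) atTop (𝓝 ((Ioo a b).indicator φ t)) := by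
    intro t ht
    by_cases htm : t ∈ Ioo a b
    · rw [indicator_of_mem htm]
      have h1 : Tendsto (fun N => (p N).eval t) atTop (𝓝 (φ t)) := by
        rw [tendsto_iff_norm_sub_tendsto_zero]
        exact squeeze_zero (fun _ => norm_nonneg _) (fun N => (hp N t ht).le)
          tendsto_one_div_add_atTop_nhds_zero_nat
      have hev : ∀ {x : ℝ}, 0 < x → ∀ᶠ N : ℕ in atTop, 1 ≤ N * x := fun hx =>
        (tendsto_natCast_atTop_atTop.atTop_mul_const hx).eventually_ge_atTop 1
      refine h1.congr' ?_
      filter_upwards [hev (sub_pos.2 htm.1), hev (sub_pos.2 htm.2)] with N h2 h3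
      simp [g, χ, Real.smoothTransition.one_of_one_le h2, Real.smoothTransition.one_of_one_le h3]
    · rw [indicator_of_notMem htm]
      refine tendsto_const_nhds.congr fun N => ?_
      have : t ≤ a ∨ b ≤ t := by
        by_contra! h
        exact htm h
      rcases this with h | h
      · have : (N : ℝ) * (t - a) ≤ 0 := mul_nonpos_of_nonneg_of_nonpos (by positivity) (by linarith)
        simp [g, χ, Real.smoothTransition.zero_of_nonpos this]
      · have : (N : ℝ) * (b - t) ≤ 0 := mul_nonpos_of_nonneg_of_nonpos (by positivity) (by linarith)
        simp [g, χ, Real.smoothTransition.zero_of_nonpos this]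
  let S : ℕ → ℝ → ℝ := fun N t => ∫ s in (0 : ℝ)..t, g N s
  have hSd : ∀ N t, HasDerivAt (S N) (g N t) t := fun N t =>
    ((hgs N).continuous.integral_hasStrictDerivAt 0 t).hasDerivAt
  have hSs : ∀ N, ContDiff ℝ ∞ (S N) := fun N => by
    rw [contDiff_infty_iff_deriv]
    refine ⟨fun t => (hSd N t).differentiableAt, ?_⟩
    rw [show deriv (S N) = g N from funext fun t => (hSd N t).deriv]
    exact hgs N
  have hSb : ∀ N, ∀ t ∈ Icc 0 L, |S N t| ≤ (M + 1) * L := fun N t ht => by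
    have := intervalIntegral.norm_integral_le_of_norm_le_const (f := g N) (a := 0) (b := t)
      (C := M + 1) fun s hs => by
        rw [uIoc_of_le ht.1] at hs
        exact hgb N s ⟨hs.1.le, hs.2.trans ht.2⟩
    rw [sub_zero, abs_of_nonneg ht.1] at this
    exact this.trans (mul_le_mul_of_nonneg_left ht.2 (by linarith))
  have hSlim : ∀ t ∈ Icc 0 L, Tendsto (fun N => S N t) atTop (𝓝 ((Ioo a b).indicator u t)) := by
    intro t ht
    rw [← integral_indicator_Ioo_deriv h0a hab hbL hu hφ ha hb ht]
    refine intervalIntegral.tendsto_integral_filter_of_dominated_convergence (fun _ => M + 1)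
      (Eventually.of_forall fun N => (hgs N).continuous.aestronglyMeasurable)
      (Eventually.of_forall fun N => Eventually.of_forall fun s hs => ?_)
      intervalIntegrable_const (Eventually.of_forall fun s hs => ?_)
    all_goals
      rw [uIoc_of_le ht.1] at hs
      have hs' : s ∈ Icc 0 L := ⟨hs.1.le, hs.2.trans ht.2⟩
    · exact hgb N s hs'
    · exact hglim s hs'
  have hmlim : Tendsto (fun N => S N L) atTop (𝓝 0) := by
    have := hSlim L ⟨hL.le, le_rfl⟩
    rwa [indicator_of_notMem (fun hm => absurd hm.2 (not_lt.2 hbL))] at this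
  -- A linear correction, tending to zero with its slope, restores the boundary value at `L`.
  let s : ℕ → ℝ → ℝ := fun N t => S N t - t * (S N L / L)
  have hs0 : ∀ N, s N 0 = 0 := fun N => by simp [s, S]
  have hs1 : ∀ N, s N L = 0 := fun N => by
    simp only [s]
    field_simp
    ring
  have hsd : ∀ N t, HasDerivAt (s N) (g N t - S N L / L) t := fun N t => by
    have := (hSd N t).sub ((hasDerivAt_id t).mul_const (S N L / L))
    rw [one_mul] at this
    exact this
  have hmb : ∀ N, |S N L / L| ≤ M + 1 := fun N => by
    rw [abs_div, abs_of_pos hL, div_le_iff₀ hL]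
    exact hSb N L ⟨hL.le, le_rfl⟩
  refine ⟨fun N => (Ioo 0 L).indicator (s N), 2 * (M + 1) + 2 * ((M + 1) * L), fun N =>
    indicator_mem_smoothDirichlet ((hSs N).sub (contDiff_id.mul contDiff_const)) (hs0 N) (hs1 N),
    fun N t ht => ?_, fun t ht => ?_⟩
  · rw [derivWithin_indicator hL (hsd N t) (hs0 N) (hs1 N) ht]
    simp only [indicator_eq_on_Icc (hs0 N) (hs1 N) ht]
    have hML : 0 ≤ (M + 1) * L := by positivity
    constructor
    · refine (abs_sub _ _).trans ?_
      linarith [hgb N t ht, hmb N]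
    · refine (abs_sub _ _).trans ?_
      have : |t * (S N L / L)| ≤ (M + 1) * L := by
        rw [abs_mul, abs_of_nonneg ht.1, mul_comm]
        exact mul_le_mul (hmb N) ht.2 ht.1 (by linarith)
      linarith [hSb N t ht]
  · have h1 : Tendsto (fun N => S N L / L) atTop (𝓝 0) := by simpa using hmlim.div_const L
    constructor
    · have := (hglim t ht).sub h1
      rw [sub_zero] at this
      exact this.congr fun N => (derivWithin_indicator hL (hsd N t) (hs0 N) (hs1 N) ht).symm
    · have := (hSlim t ht).sub (h1.const_mul t)
      rw [mul_zero, sub_zero] at this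
      exact this.congr fun N => (indicator_eq_on_Icc (hs0 N) (hs1 N) ht).symm

/-- A sequence of quadratic forms tending to a positive diagonal one is eventually positive
definite. -/
lemma eventually_posDef_of_tendsto_diagonal {n : ℕ} {A : ℕ → Fin n → Fin n → ℝ} {d : Fin n → ℝ}
    (hd : ∀ i, 0 < d i)
    (hA : ∀ i j, Tendsto (fun N => A N i j) atTop (𝓝 (if i = j then d i else 0))) :
    ∀ᶠ N in atTop, ∀ c : Fin n → ℝ, c ≠ 0 → 0 < ∑ i, ∑ j, c i * c j * A N i j := by
  obtain ⟨m, hm0, hm⟩ : ∃ m, 0 < m ∧ ∀ i, m ≤ d i := by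
    rcases isEmpty_or_nonempty (Fin n) with h | h
    · exact ⟨1, one_pos, fun i => h.elim i⟩
    · obtain ⟨i, hi⟩ := Finite.exists_min d
      exact ⟨d i, hd i, hi⟩
  -- Since `|c i * c j| ≤ (c i² + c j²) / 2`, entrywise errors below `ε` cost at most `ε n ∑ c i²`,
  -- which must stay below `m ∑ c i²`.
  set ε := m / (n + 1) with hε
  have hε0 : 0 < ε := by positivity
  have hεn : ε * n < m := by
    rw [hε, div_mul_eq_mul_div, div_lt_iff₀ (by positivity)]
    linarith
  have hev : ∀ᶠ N in atTop, ∀ i j, |A N i j - if i = j then d i else 0| < ε := by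
    rw [eventually_all]
    intro i
    rw [eventually_all]
    intro j
    simpa [Real.dist_eq] using (Metric.tendsto_nhds.1 (hA i j)) ε hε0
  filter_upwards [hev] with N hN c hc
  have hterm : ∀ i j, (if i = j then d i * c i ^ 2 else 0) - ε * (c i ^ 2 + c j ^ 2) / 2 ≤
      c i * c j * A N i j := by
    intro i j
    have h1 : c i * c j * A N i j = c i * c j * (if i = j then d i else 0) +
        c i * c j * (A N i j - if i = j then d i else 0) := by ring
    have h2 : c i * c j * (if i = j then d i else 0) = if i = j then d i * c i ^ 2 else 0 := by
      split_ifs with h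
      · subst h; ring
      · ring
    have h3 : |c i * c j * (A N i j - if i = j then d i else 0)| ≤ |c i * c j| * ε := by
      rw [abs_mul]
      exact mul_le_mul_of_nonneg_left (hN i j).le (abs_nonneg _)
    have h4 : |c i * c j| ≤ (c i ^ 2 + c j ^ 2) / 2 := by
      rw [abs_le]
      constructor <;> nlinarith [sq_nonneg (c i + c j), sq_nonneg (c i - c j)]
    have h5 := neg_abs_le (c i * c j * (A N i j - if i = j then d i else 0))
    rw [h1, h2]
    nlinarith [mul_le_mul_of_nonneg_right h4 hε0.le]
  have hpos : 0 < ∑ i, c i ^ 2 := by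
    obtain ⟨i, hi⟩ := Function.ne_iff.1 hc
    exact Finset.sum_pos' (fun i _ => sq_nonneg _) ⟨i, Finset.mem_univ _, by
      have : c i ≠ 0 := hi
      positivity⟩
  calc 0 < (m - ε * n) * ∑ i, c i ^ 2 := mul_pos (by linarith) hpos
    _ ≤ ∑ i, d i * c i ^ 2 - ε * n * ∑ i, c i ^ 2 := by
      rw [sub_mul, Finset.mul_sum]
      gcongr with i
      exact hm i
    _ = ∑ i, ∑ j, ((if i = j then d i * c i ^ 2 else 0) - ε * (c i ^ 2 + c j ^ 2) / 2) := by
      simp only [Finset.sum_sub_distrib, Finset.sum_ite_eq, Finset.mem_univ, if_true, mul_add,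
        add_div, Finset.sum_add_distrib, Finset.sum_const, Finset.card_univ, Fintype.card_fin,
        nsmul_eq_mul, ← Finset.mul_sum, ← Finset.sum_div]
      ring
    _ ≤ _ := Finset.sum_le_sum fun i _ => Finset.sum_le_sum fun j _ => hterm i j

/-- A Prüfer angle comes from a solution `u` of `(v u')' = (k² / v - μ v) u`, with `z = v u'`. -/
lemma IsPruferAngle.exists_solution {k μ : ℝ} {v : ℝ → ℝ} (hv : Continuous v)
    (hpos : ∀ t, 0 < v t) {L : ℝ} (hL : 0 ≤ L) {θ : ℝ → ℝ} (h : IsPruferAngle k μ v L θ) :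
    ∃ u z : ℝ → ℝ, (∀ t ∈ Icc 0 L, HasDerivAt u (z t / v t) t) ∧
      (∀ t ∈ Icc 0 L, HasDerivAt z ((k ^ 2 / v t - μ * v t) * u t) t) ∧
      ∀ t, u t = 0 ↔ Real.sin (θ t) = 0 := by
  have hne : ∀ t, v t ≠ 0 := fun t => (hpos t).ne'
  have hθ : Continuous fun t => θ (projIcc 0 L hL t) :=
    (continuousOn_iff_continuous_domRestrict.1 h.continuousOn).comp continuous_projIcc
  -- The logarithmic derivative of the Prüfer radius; `projIcc` extends it continuously to the line.
  set κ : ℝ → ℝ := fun t => Real.sin (θ (projIcc 0 L hL t)) * Real.cos (θ (projIcc 0 L hL t)) *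
    (1 / v t + k ^ 2 / v t - μ * v t) with hκ
  have hκc : Continuous κ := by
    have h1 := continuous_div_weight hv hpos 1
    have h2 := continuous_div_weight hv hpos (k ^ 2)
    exact ((Real.continuous_sin.comp hθ).mul (Real.continuous_cos.comp hθ)).mul
      ((h1.add h2).sub (hv.const_mul μ))
  set ρ : ℝ → ℝ := fun t => Real.exp (∫ s in (0 : ℝ)..t, κ s) with hρ
  have hρd : ∀ t, HasDerivAt ρ (ρ t * κ t) t := fun t =>
    (hκc.integral_hasStrictDerivAt 0 t).hasDerivAt.exp
  have hκt : ∀ t ∈ Icc 0 L, κ t = Real.sin (θ t) * Real.cos (θ t) *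
      (1 / v t + k ^ 2 / v t - μ * v t) := fun t ht => by
    simp only [hκ, projIcc_of_mem hL ht]
  refine ⟨fun t => ρ t * Real.sin (θ t), fun t => ρ t * Real.cos (θ t), fun t ht => ?_,
    fun t ht => ?_, fun t => ?_⟩
  · refine ((hρd t).mul (h.2 t ht).sin).congr_deriv ?_
    rw [hκt t ht, pruferField]
    have := Real.sin_sq_add_cos_sq (θ t)
    linear_combination (ρ t * Real.cos (θ t) / v t) * this
  · refine ((hρd t).mul (h.2 t ht).cos).congr_deriv ?_
    rw [hκt t ht, pruferField]
    have := Real.sin_sq_add_cos_sq (θ t)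
    linear_combination (ρ t * Real.sin (θ t) * (k ^ 2 / v t - μ * v t)) * this
  · simp [hρ, (Real.exp_pos _).ne']

/-- Decreasing sequence of nodes of a solution. -/
lemma IsPruferAngle.exists_nodes {k μ : ℝ} {v : ℝ → ℝ} (hpos : ∀ t, 0 < v t) {L : ℝ}
    (hL : 0 < L) {θ : ℝ → ℝ} (h : IsPruferAngle k μ v L θ) {n : ℕ}
    (hn : θ 0 ≤ -(n * Real.pi)) :
    ∃ x : ℕ → ℝ, (∀ j ≤ n, x j ∈ Icc 0 L) ∧ (∀ j ≤ n, Real.sin (θ (x j)) = 0) ∧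
      (∀ j < n, x (j + 1) < x j) ∧
      ∀ j < n, ∀ t ∈ Ioo (x (j + 1)) (x j), Real.sin (θ t) ≠ 0 := by
  -- `x j` is where `θ = -jπ`. Angles are counted from `L`, so the nodes decrease with `j`.
  have hex : ∀ j : ℕ, ∃ t, j ≤ n → t ∈ Icc 0 L ∧ θ t = ((-(j : ℤ) : ℤ) : ℝ) * Real.pi := by
    intro j
    by_cases hj : j ≤ n
    · have hmem : ((-(j : ℤ) : ℤ) : ℝ) * Real.pi ∈ Icc (θ 0) (θ L) := by
        rw [h.1]
        have h1 : (j : ℝ) * Real.pi ≤ n * Real.pi :=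
          mul_le_mul_of_nonneg_right (by exact_mod_cast hj) Real.pi_pos.le
        have h2 : 0 ≤ (j : ℝ) * Real.pi := mul_nonneg (Nat.cast_nonneg j) Real.pi_pos.le
        push_cast
        constructor <;> linarith
      obtain ⟨t, ht, hθt⟩ := intermediate_value_Icc hL.le h.continuousOn hmem
      exact ⟨t, fun _ => ⟨ht, hθt⟩⟩
    · exact ⟨0, fun h => absurd h hj⟩
  choose x hx using hex
  have hlt : ∀ j < n, x (j + 1) < x j := by
    intro j hj
    obtain ⟨h1, h2⟩ := hx (j + 1) hj
    obtain ⟨h3, h4⟩ := hx j hj.le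
    have hstep : ((-((j + 1 : ℕ) : ℤ) : ℤ) : ℝ) * Real.pi < ((-(j : ℤ) : ℤ) : ℝ) * Real.pi := by
      push_cast
      linarith [Real.pi_pos]
    by_contra! hc
    rcases hc.lt_or_eq with hc | hc
    · have := h.lt_of_le hpos _ h3.1 hc h1.2 h4.ge
      linarith
    · rw [← hc] at h2
      linarith
  refine ⟨x, fun j hj => (hx j hj).1, fun j hj => ?_, hlt, fun j hj t ht hs => ?_⟩
  · rw [(hx j hj).2]
    exact Real.sin_int_mul_pi _
  · obtain ⟨h1, h2⟩ := hx (j + 1) hj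
    obtain ⟨h3, h4⟩ := hx j hj.le
    obtain ⟨m, hm⟩ := Real.sin_eq_zero_iff.1 hs
    have h5 := h.lt_of_le hpos _ h1.1 ht.1 (ht.2.le.trans h3.2) h2.ge
    have h6 := h.lt_of_le hpos m (h1.1.trans ht.1.le) ht.2 h3.2 hm.le
    rw [← hm] at h5
    rw [h4] at h6
    have h7 : (-((j + 1 : ℕ) : ℤ) : ℤ) < m := by
      exact_mod_cast lt_of_mul_lt_mul_right h5 Real.pi_pos.le
    have h8 : m < (-(j : ℤ) : ℤ) := by
      exact_mod_cast lt_of_mul_lt_mul_right h6 Real.pi_pos.le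
    omega

/-- Dominated convergence; the limits need not be smooth, so truncated nodal pieces are allowed. -/
lemma tendsto_weightedForm {L : ℝ} (hL : 0 < L) {p q : ℝ → ℝ} (hp : Continuous p)
    (hq : Continuous q) {u w : ℕ → smoothDirichlet L} {C D : ℝ} {f f' g g' : ℝ → ℝ}
    (hub : ∀ N, ∀ t ∈ Icc 0 L, |derivWithin (u N : ℝ → ℝ) (Icc 0 L) t| ≤ C ∧
      |(u N : ℝ → ℝ) t| ≤ C)
    (hwb : ∀ N, ∀ t ∈ Icc 0 L, |derivWithin (w N : ℝ → ℝ) (Icc 0 L) t| ≤ D ∧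
      |(w N : ℝ → ℝ) t| ≤ D)
    (hu : ∀ t ∈ Icc 0 L, Tendsto (fun N => derivWithin (u N : ℝ → ℝ) (Icc 0 L) t) atTop
      (𝓝 (f' t)) ∧ Tendsto (fun N => (u N : ℝ → ℝ) t) atTop (𝓝 (f t)))
    (hw : ∀ t ∈ Icc 0 L, Tendsto (fun N => derivWithin (w N : ℝ → ℝ) (Icc 0 L) t) atTop
      (𝓝 (g' t)) ∧ Tendsto (fun N => (w N : ℝ → ℝ) t) atTop (𝓝 (g t))) :
    Tendsto (fun N => weightedForm hL hp hq (u N) (w N)) atTop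
      (𝓝 (∫ t in (0 : ℝ)..L, (f' t * g' t * p t + f t * g t * q t))) := by
  have hC : 0 ≤ C := (abs_nonneg _).trans (hub 0 0 ⟨le_rfl, hL.le⟩).1
  have hIoc : ∀ {t}, t ∈ uIoc 0 L → t ∈ Icc 0 L := fun ht => by
    rw [uIoc_of_le hL.le] at ht
    exact Ioc_subset_Icc_self ht
  simp only [weightedForm_apply]
  refine intervalIntegral.tendsto_integral_filter_of_dominated_convergence
    (fun t => C * D * |p t| + C * D * |q t|)
    (Eventually.of_forall fun N =>
      (intervalIntegrable_iff.1
        (intervalIntegrable_weightedForm hL hp hq (u N).2 (w N).2)).aestronglyMeasurable)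
    (Eventually.of_forall fun N => Eventually.of_forall fun t ht => ?_)
    (Continuous.intervalIntegrable (by fun_prop) _ _)
    (Eventually.of_forall fun t ht => ?_)
  · obtain ⟨h1, h2⟩ := hub N t (hIoc ht)
    obtain ⟨h3, h4⟩ := hwb N t (hIoc ht)
    refine (norm_add_le _ _).trans (add_le_add ?_ ?_) <;>
      rw [Real.norm_eq_abs, abs_mul, abs_mul] <;>
      refine mul_le_mul_of_nonneg_right ?_ (abs_nonneg _)
    · exact mul_le_mul h1 h3 (abs_nonneg _) hC
    · exact mul_le_mul h2 h4 (abs_nonneg _) hC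
  · obtain ⟨h1, h2⟩ := hu t (hIoc ht)
    obtain ⟨h3, h4⟩ := hw t (hIoc ht)
    exact ((h1.mul h3).mul_const _).add ((h2.mul h4).mul_const _)

/-- Positive definiteness of the Gram matrix also gives linear independence, hence the dimension. -/
lemma exists_subspace_of_posDef {L : ℝ} (hL : 0 < L) {p q : ℝ → ℝ} (hp : Continuous p)
    (hq : Continuous q) {n : ℕ} (b : Fin n → smoothDirichlet L)
    (hb : ∀ c : Fin n → ℝ, c ≠ 0 →
      0 < ∑ i, ∑ j, c i * c j * weightedForm hL hp hq (b i) (b j)) :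
    ∃ W : Submodule ℝ (ℝ → ℝ), W ≤ smoothDirichlet L ∧ Module.finrank ℝ W = n ∧
      ∀ w : smoothDirichlet L, (w : ℝ → ℝ) ∈ W → w ≠ 0 → 0 < weightedForm hL hp hq w w := by
  have hli : LinearIndependent ℝ b := by
    rw [Fintype.linearIndependent_iff]
    intro c hc
    by_contra! h
    obtain ⟨i, hi⟩ := h
    have := hb c fun h0 => hi (congrFun h0 i)
    rw [← weightedForm_sum, hc] at this
    simp at this
  refine ⟨(Submodule.span ℝ (range b)).map (smoothDirichlet L).subtype,
    Submodule.map_subtype_le _ _, ?_, fun w hw hw0 => ?_⟩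
  · rw [← (Submodule.equivMapOfInjective _ (Submodule.injective_subtype _) _).finrank_eq,
      finrank_span_eq_card hli, Fintype.card_fin]
  · obtain ⟨w', hw', hww⟩ := hw
    obtain rfl : w' = w := Subtype.ext hww
    obtain ⟨c, rfl⟩ := Submodule.mem_span_range_iff_exists_fun ℝ |>.1 hw'
    rw [weightedForm_sum]
    exact hb c fun h0 => hw0 (by simp [h0])

/-- If the solution for `μ` has `n` nodes, then spaces of test functions that approximate its
nodal pieces have Rayleigh quotients below any `μ' > μ`. -/
lemma IsPruferAngle.exists_subspace {k μ μ' : ℝ} {v : ℝ → ℝ} (hv : Continuous v)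
    (hpos : ∀ t, 0 < v t) {L : ℝ} (hL : 0 < L) {θ : ℝ → ℝ} (h : IsPruferAngle k μ v L θ)
    {n : ℕ} (hn : θ 0 ≤ -(n * Real.pi)) (hμ : μ < μ') :
    ∃ W : Submodule ℝ (ℝ → ℝ), W ≤ smoothDirichlet L ∧ Module.finrank ℝ W = n ∧
      ∀ w ∈ W, w ≠ 0 → weightedEnergy v L k w < μ' * weightedMass v L w := by
  have hne : ∀ t, v t ≠ 0 := fun t => (hpos t).ne'
  obtain ⟨u, z, hu, hz, huz⟩ := h.exists_solution hv hpos hL.le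
  obtain ⟨x, hxm, hx0, hxlt, hxne⟩ := h.exists_nodes hpos hL hn
  have huc : ContinuousOn u (Icc 0 L) := fun t ht => (hu t ht).continuousAt.continuousWithinAt
  have hzc : ContinuousOn z (Icc 0 L) := fun t ht => (hz t ht).continuousAt.continuousWithinAt
  set φ : ℝ → ℝ := fun t => z t / v t with hφ
  have hφc : ContinuousOn φ (Icc 0 L) := hzc.div hv.continuousOn fun t _ => hne t
  have hsub : ∀ i : Fin n, Icc (x (i + 1)) (x i) ⊆ Icc 0 L := fun i =>
    Icc_subset_Icc (hxm _ i.2).1 (hxm _ i.2.le).2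
  have hux : ∀ j ≤ n, u (x j) = 0 := fun j hj => (huz _).2 (hx0 j hj)
  choose w C hwd hwb hwl using fun i : Fin n =>
    exists_smoothDirichlet_approx (hxm _ i.2).1 (hxlt i i.2) (hxm _ i.2.le).2 hu hφc
      (hux _ i.2) (hux _ i.2.le)
  set p : ℝ → ℝ := -v with hp'
  have hp : Continuous p := hv.neg
  -- With these `p` and `q` the form is `μ' * mass - energy`.
  set q : ℝ → ℝ := (fun t => μ' * v t) - fun t => k ^ 2 / v t with hq'
  have hq : Continuous q := (hv.const_mul μ').sub (continuous_div_weight hv hpos (k ^ 2))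
  have hxanti : ∀ i j, i ≤ j → j ≤ n → x j ≤ x i := by
    intro i j hij
    induction hij with
    | refl => exact fun _ => le_rfl
    | step _ ih => exact fun hm => (hxlt _ hm).le.trans (ih (Nat.le_of_succ_le hm))
  have hdisj : ∀ i j : Fin n, i ≠ j → ∀ t,
      t ∈ Ioo (x (i + 1)) (x i) → t ∉ Ioo (x (j + 1)) (x j) := by
    intro i j hij t h1 h2
    rcases lt_or_gt_of_ne hij with hlt | hlt
    · exact absurd (h2.2.trans_le (hxanti (i + 1) j hlt j.2.le)) (not_lt.2 h1.1.le)
    · exact absurd (h1.2.trans_le (hxanti (j + 1) i hlt i.2.le)) (not_lt.2 h2.1.le)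
  set d : Fin n → ℝ := fun i => ∫ t in x (i + 1)..x i, (φ t * φ t * p t + u t * u t * q t) with hd
  have hdpos : ∀ i, 0 < d i := by
    intro i
    have hle := (hxlt i i.2).le
    -- The integrand is `(u z)'` and `u` vanishes at both nodes, so energy equals `μ * mass` on a
    -- nodal interval and `d i = (μ' - μ) ∫ u² v`.
    have hfin : ∫ t in x (i + 1)..x i, (φ t * z t + u t * ((k ^ 2 / v t - μ * v t) * u t)) = 0 := by
      rw [intervalIntegral.integral_eq_sub_of_hasDerivAt (f := fun t => u t * z t)]
      · simp [hux _ i.2, hux _ i.2.le]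
      · intro t ht
        rw [uIcc_of_le hle] at ht
        exact (hu t (hsub i ht)).mul (hz t (hsub i ht))
      · refine ContinuousOn.intervalIntegrable ?_
        rw [uIcc_of_le hle]
        refine ContinuousOn.mono ?_ (hsub i)
        exact (hφc.mul hzc).add (huc.mul
          (((continuous_div_weight hv hpos (k ^ 2)).sub (hv.const_mul μ)).continuousOn.mul huc))
    have hdi : d i = (∫ t in x (i + 1)..x i, (μ' - μ) * (u t * u t * v t)) -
        ∫ t in x (i + 1)..x i, (φ t * z t + u t * ((k ^ 2 / v t - μ * v t) * u t)) := by
      rw [← intervalIntegral.integral_sub]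
      · refine intervalIntegral.integral_congr fun t _ => ?_
        have := hne t
        simp only [hφ, hp', hq', Pi.neg_apply, Pi.sub_apply]
        field_simp
        ring
      · refine ContinuousOn.intervalIntegrable ?_
        rw [uIcc_of_le hle]
        refine ContinuousOn.mono ?_ (hsub i)
        exact continuousOn_const.mul ((huc.mul huc).mul hv.continuousOn)
      · refine ContinuousOn.intervalIntegrable ?_
        rw [uIcc_of_le hle]
        refine ContinuousOn.mono ?_ (hsub i)
        exact (hφc.mul hzc).add (huc.mul
          (((continuous_div_weight hv hpos (k ^ 2)).sub (hv.const_mul μ)).continuousOn.mul huc))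
    rw [hdi, hfin, sub_zero]
    refine intervalIntegral.intervalIntegral_pos_of_pos_on ?_ (fun t ht => ?_) (hxlt i i.2)
    · refine ContinuousOn.intervalIntegrable ?_
      rw [uIcc_of_le hle]
      refine ContinuousOn.mono ?_ (hsub i)
      exact continuousOn_const.mul ((huc.mul huc).mul hv.continuousOn)
    · have h1 : u t ≠ 0 := fun h0 => hxne i i.2 t ht ((huz t).1 h0)
      exact mul_pos (sub_pos.2 hμ) (mul_pos (mul_self_pos.2 h1) (hpos t))
  have hlim : ∀ i j, Tendsto (fun N => weightedForm hL hp hq ⟨w i N, hwd i N⟩ ⟨w j N, hwd j N⟩)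
      atTop (𝓝 (if i = j then d i else 0)) := by
    intro i j
    have ht := tendsto_weightedForm hL hp hq (u := fun N => ⟨w i N, hwd i N⟩)
      (w := fun N => ⟨w j N, hwd j N⟩) (hwb i) (hwb j) (hwl i) (hwl j)
    convert! ht using 2
    split_ifs with hij
    · subst hij
      have : ∀ t, (Ioo (x (i + 1)) (x i)).indicator φ t * (Ioo (x (i + 1)) (x i)).indicator φ t *
          p t + (Ioo (x (i + 1)) (x i)).indicator u t * (Ioo (x (i + 1)) (x i)).indicator u t *
          q t = (Ioo (x (i + 1)) (x i)).indicator (fun t => φ t * φ t * p t + u t * u t * q t) t := by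
        intro t
        by_cases ht : t ∈ Ioo (x (i + 1)) (x i) <;> simp [ht]
      refine Eq.trans ?_ (intervalIntegral.integral_congr fun t _ => (this t).symm)
      simp only [hd]
      rw [intervalIntegral.integral_of_le (hxlt i i.2).le, intervalIntegral.integral_of_le hL.le,
        integral_Ioc_eq_integral_Ioo, setIntegral_indicator measurableSet_Ioo]
      congr 2
      refine (inter_eq_self_of_subset_right fun t ht => ?_).symm
      exact ⟨(hxm _ i.2).1.trans_lt ht.1, ht.2.le.trans (hxm _ i.2.le).2⟩
    · symm
      refine (intervalIntegral.integral_congr (g := fun _ => 0) fun t _ => ?_).trans (by simp)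
      by_cases ht : t ∈ Ioo (x (i + 1)) (x i)
      · simp [ht, hdisj i j hij t ht]
      · simp [ht]
  obtain ⟨N, hN⟩ := (eventually_posDef_of_tendsto_diagonal hdpos hlim).exists
  obtain ⟨W, hW, hWn, hWpos⟩ :=
    exists_subspace_of_posDef hL hp hq (fun i => ⟨w i N, hwd i N⟩) hN
  refine ⟨W, hW, hWn, fun f hf hf0 => ?_⟩
  have h1 := hWpos ⟨f, hW hf⟩ hf fun h0 => hf0 (congrArg Subtype.val h0)
  have h2 := sub_weightedEnergy_eq k μ' hL hv hpos ⟨f, hW hf⟩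
  have h3 : 0 < μ' * weightedMass v L f - weightedEnergy v L k f := by
    rw [h2]
    exact h1
  linarith

/-! ### Positivity and comparison of Prüfer angles -/

/-- Supplies the exponents of the integrating factors used below. -/
lemma exists_hasDerivAt_eq_on_Icc {b : ℝ → ℝ} {L : ℝ} (hL : 0 ≤ L) (hb : ContinuousOn b (Icc 0 L)) :
    ∃ B : ℝ → ℝ, ContDiff ℝ 1 B ∧ B 0 = 0 ∧ ∀ t ∈ Icc 0 L, HasDerivAt B (b t) t := by
  have hc : Continuous fun t => b (projIcc 0 L hL t) :=
    (continuousOn_iff_continuous_domRestrict.1 hb).comp continuous_projIcc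
  have hd : ∀ t, HasDerivAt (fun t => ∫ s in (0 : ℝ)..t, b (projIcc 0 L hL s))
      (b (projIcc 0 L hL t)) t := fun t => (hc.integral_hasStrictDerivAt 0 t).hasDerivAt
  refine ⟨fun t => ∫ s in (0 : ℝ)..t, b (projIcc 0 L hL s), ?_, intervalIntegral.integral_same,
    fun t ht => ?_⟩
  · rw [contDiff_one_iff_deriv]
    refine ⟨fun t => (hd t).differentiableAt, ?_⟩
    rw [funext fun t => (hd t).deriv]
    exact hc
  · simpa only [projIcc_of_mem hL ht] using hd t

/-- For `μ ≥ 0` the right side is nondecreasing in `v > 0`, which lets positivity pass to a larger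
weight. -/
lemma mul_pruferField {v : ℝ} (hv : 0 < v) (k μ θ : ℝ) :
    v * pruferField k μ v θ = Real.cos θ ^ 2 + (μ * v ^ 2 - k ^ 2) * Real.sin θ ^ 2 := by
  rw [pruferField]
  field_simp

/-- For a nonincreasing weight the Prüfer angle normalized at the right endpoint is increasing. -/
lemma IsPruferAngle.pruferField_pos {k μ : ℝ} (hμ : 0 ≤ μ) {v v' : ℝ → ℝ} (hv : Continuous v)
    (hpos : ∀ t, 0 < v t) {L : ℝ} (hL : 0 ≤ L) {θ : ℝ → ℝ} (h : IsPruferAngle k μ v L θ)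
    (hd : ∀ t ∈ Ioo 0 L, HasDerivAt v (v' t) t) (hv' : ∀ t ∈ Ioo 0 L, v' t ≤ 0) :
    ∀ t ∈ Icc 0 L, 0 < pruferField k μ (v t) (θ t) := by
  have hne : ∀ t, v t ≠ 0 := fun t => (hpos t).ne'
  have hθ := h.continuousOn
  -- `H = v θ'` satisfies `H' = b H + 2 μ v v' sin² θ` and `H L = 1`. As `v' ≤ 0`, the integrating
  -- factor makes `H` times `exp (-B)` nonincreasing, so `H` is positive up to `L`.
  set H : ℝ → ℝ := fun t => Real.cos (θ t) ^ 2 + (μ * v t ^ 2 - k ^ 2) * Real.sin (θ t) ^ 2 with hH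
  have hsc : ContinuousOn (fun t => Real.sin (θ t)) (Icc 0 L) := Real.continuous_sin.comp_continuousOn hθ
  have hcc : ContinuousOn (fun t => Real.cos (θ t)) (Icc 0 L) := Real.continuous_cos.comp_continuousOn hθ
  have hvc := hv.continuousOn (s := Icc 0 L)
  have hHc : ContinuousOn H (Icc 0 L) :=
    (hcc.pow 2).add (((continuousOn_const.mul (hvc.pow 2)).sub continuousOn_const).mul (hsc.pow 2))
  set b : ℝ → ℝ := fun t => 2 * Real.sin (θ t) * Real.cos (θ t) * (μ * v t ^ 2 - k ^ 2 - 1) / v t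
    with hb
  have hbc : ContinuousOn b (Icc 0 L) :=
    (((continuousOn_const.mul hsc).mul hcc).mul (((continuousOn_const.mul (hvc.pow 2)).sub
      continuousOn_const).sub continuousOn_const)).div hvc fun t _ => hne t
  obtain ⟨B, hBs, -, hBd⟩ := exists_hasDerivAt_eq_on_Icc hL hbc
  have hED : ∀ t ∈ Ioo 0 L, HasDerivAt (fun t => H t * Real.exp (-B t))
      (2 * μ * v t * v' t * Real.sin (θ t) ^ 2 * Real.exp (-B t)) t := by
    intro t ht
    have htI := Ioo_subset_Icc_self ht
    have h1 := (h.2 t htI).sin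
    have h2 := (h.2 t htI).cos
    have h3 := (((h2.pow 2).add (((((hd t ht).pow 2).const_mul μ).sub_const (k ^ 2)).mul
      (h1.pow 2))).mul (hBd t htI).neg.exp)
    refine h3.congr_deriv ?_
    have hf : pruferField k μ (v t) (θ t) = H t / v t := by
      rw [eq_div_iff (hne t), mul_comm, mul_pruferField (hpos t)]
    simp only [Pi.add_apply, Pi.mul_apply, Pi.pow_apply, hf]
    simp only [hH, hb]
    have := hne t
    field_simp
    norm_num
    ring
  have hanti : AntitoneOn (fun t => H t * Real.exp (-B t)) (Icc 0 L) := by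
    refine antitoneOn_of_deriv_nonpos (convex_Icc 0 L)
      (hHc.mul (Real.continuous_exp.comp_continuousOn hBs.continuous.continuousOn.neg))
      (fun t ht => ?_) fun t ht => ?_
    all_goals rw [interior_Icc] at ht
    · exact (hED t ht).differentiableAt.differentiableWithinAt
    · rw [(hED t ht).deriv]
      have h1 : v' t * (2 * μ * v t * Real.sin (θ t) ^ 2 * Real.exp (-B t)) ≤ 0 :=
        mul_nonpos_of_nonpos_of_nonneg (hv' t ht) (by have := hpos t; positivity)
      linarith
  intro t ht
  have h1 := hanti ht ⟨hL, le_rfl⟩ ht.2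
  have h2 : H L = 1 := by simp [hH, h.1]
  simp only [h2] at h1
  have h3 : 0 < H t := by
    by_contra! hc
    have : H t * Real.exp (-B t) ≤ 0 := mul_nonpos_of_nonpos_of_nonneg hc (Real.exp_pos _).le
    linarith [Real.exp_pos (-B L)]
  have h4 : 0 < v t * pruferField k μ (v t) (θ t) := by
    rw [mul_pruferField (hpos t)]
    exact h3
  exact (mul_pos_iff_of_pos_left (hpos t)).1 h4

lemma IsPruferAngle.exists_lipschitzOnWith {k μ : ℝ} {v : ℝ → ℝ} (hv : Continuous v)
    (hpos : ∀ t, 0 < v t) {L : ℝ} {θ : ℝ → ℝ} (h : IsPruferAngle k μ v L θ) :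
    ∃ K, LipschitzOnWith K θ (Icc 0 L) := by
  obtain ⟨M, hM0, hM⟩ := exists_bound_Icc
    (f := fun t => |1 / v t| + |μ * v t - k ^ 2 / v t|)
    ((continuous_div_weight hv hpos 1).abs.add
      ((hv.const_mul μ).sub (continuous_div_weight hv hpos (k ^ 2))).abs) 0 L
  refine ⟨⟨M, hM0.le⟩, (convex_Icc 0 L).lipschitzOnWith_of_nnnorm_hasDerivWithin_le
    (fun t ht => (h.2 t ht).hasDerivWithinAt) fun t ht => ?_⟩
  exact (abs_pruferField_le ..).trans ((le_abs_self _).trans (hM t ht))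

/-- Comparison of a Prüfer angle with a Lipschitz subsolution, with the case of equality. -/
lemma IsPruferAngle.lt_or_ae_eq {k μ : ℝ} {v : ℝ → ℝ} (hv : Continuous v) (hpos : ∀ t, 0 < v t)
    {L : ℝ} (hL : 0 < L) {θ ψ : ℝ → ℝ} (h : IsPruferAngle k μ v L θ) {K : NNReal}
    (hψ : LipschitzOnWith K ψ (Icc 0 L)) (hψL : ψ L = 0)
    (hsub : ∀ᵐ t ∂volume.restrict (Ioc 0 L), deriv ψ t ≤ pruferField k μ (v t) (ψ t)) :
    θ 0 < ψ 0 ∨ ∀ᵐ t ∂volume.restrict (Ioc 0 L), deriv ψ t = pruferField k μ (v t) (ψ t) := by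
  obtain ⟨K', hθ⟩ := h.exists_lipschitzOnWith hv hpos
  have hψc := hψ.continuousOn
  have hθc := hθ.continuousOn
  have hvc := hv.continuousOn (s := Icc 0 L)
  have hβ : ContinuousOn (fun t => pruferSlope k μ (v t) (ψ t) (θ t)) (Icc 0 L) := by
    unfold pruferSlope
    have h1 := (continuous_div_weight hv hpos (k ^ 2)).continuousOn (s := Icc 0 L)
    have h2 := (continuous_div_weight hv hpos 1).continuousOn (s := Icc 0 L)
    exact (((continuousOn_const.mul hvc).sub h1).sub h2).mul
      ((Real.continuous_sinc.comp_continuousOn (hψc.sub hθc)).mul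
        (Real.continuous_sin.comp_continuousOn (hψc.add hθc)))
  obtain ⟨B, hBs, hB0, hBd⟩ := exists_hasDerivAt_eq_on_Icc hL.le hβ
  -- The integrating factor turns the subsolution inequality into `e' ≤ 0` almost everywhere.
  -- Absolute continuity permits integration: `ψ 0 - θ 0 = ∫ -e' ≥ 0`, with equality only if `e' =
  -- 0` almost everywhere.
  set e : ℝ → ℝ := fun t => (ψ t - θ t) * Real.exp (-B t) with he
  have hAC : AbsolutelyContinuousOnInterval e 0 L := by
    rw [← uIcc_of_le hL.le] at hψ hθ
    exact (hψ.absolutelyContinuousOnInterval.sub hθ.absolutelyContinuousOnInterval).mul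
      (hBs.neg.exp.contDiffOn.absolutelyContinuousOnInterval)
  have hψd : ∀ᵐ t ∂volume.restrict (Ioc 0 L), t ∈ Ioo 0 L ∧ DifferentiableAt ℝ ψ t := by
    rw [← Measure.restrict_congr_set Ioo_ae_eq_Ioc, ae_restrict_iff' measurableSet_Ioo]
    rw [← uIcc_of_le hL.le] at hψ
    filter_upwards [hψ.absolutelyContinuousOnInterval.ae_differentiableAt] with t ht htm
    refine ⟨htm, ht ?_⟩
    rw [uIcc_of_le hL.le]
    exact Ioo_subset_Icc_self htm
  have hed : ∀ t ∈ Ioo 0 L, DifferentiableAt ℝ ψ t →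
      deriv e t = (deriv ψ t - pruferField k μ (v t) (ψ t)) * Real.exp (-B t) := by
    intro t ht hd
    have htI := Ioo_subset_Icc_self ht
    have h1 := ((hd.hasDerivAt.sub (h.2 t htI)).mul (hBd t htI).neg.exp).deriv
    rw [show e = (ψ - θ) * fun t => Real.exp ((-B) t) from rfl, h1]
    have h2 := pruferField_sub k μ (v t) (ψ t) (θ t)
    simp only [Pi.sub_apply, Pi.neg_apply]
    linear_combination (Real.exp (-B t)) * h2
  have hle : ∀ᵐ t ∂volume.restrict (Ioc 0 L), 0 ≤ -deriv e t := by
    filter_upwards [hψd, hsub] with t ht hst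
    rw [hed t ht.1 ht.2, ← neg_mul]
    exact mul_nonneg (by linarith) (Real.exp_pos _).le
  have hint := hAC.integral_deriv_eq_sub
  have heL : e L = 0 := by simp [he, hψL, h.1]
  have he0 : e 0 = ψ 0 - θ 0 := by simp [he, hB0]
  have hint' : ∫ t in (0 : ℝ)..L, -deriv e t = ψ 0 - θ 0 := by
    rw [intervalIntegral.integral_neg, hint, heL, he0]
    ring
  have hge : 0 ≤ ψ 0 - θ 0 := by
    rw [← hint']
    exact intervalIntegral.integral_nonneg_of_ae_restrict hL.le
      (by rwa [← Measure.restrict_congr_set Ioc_ae_eq_Icc])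
  rcases hge.lt_or_eq with hlt | heq
  · exact Or.inl (by linarith)
  · right
    have h0 := (intervalIntegral.integral_eq_zero_iff_of_le_of_nonneg_ae hL.le hle
      hAC.intervalIntegrable_deriv.neg).1 (hint'.trans heq.symm)
    filter_upwards [hψd, h0] with t ht h0t
    have h1 : -deriv e t = 0 := h0t
    rw [hed t ht.1 ht.2, neg_eq_zero, mul_eq_zero] at h1
    exact sub_eq_zero.1 (h1.resolve_right (Real.exp_pos _).ne')

/-! ### Running maxima of 1-Lipschitz functions -/

/-- The running maximum of `f` on `[0, t]`. -/
noncomputable def runningMax (f : ℝ → ℝ) (t : ℝ) : ℝ := sSup (f '' Icc 0 t)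

section runningMax

variable {f : ℝ → ℝ} {s t c : ℝ}

lemma le_runningMax (hf : Continuous f) (hs : 0 ≤ s) (hst : s ≤ t) : f s ≤ runningMax f t :=
  le_csSup (isCompact_Icc.image hf).bddAbove ⟨s, ⟨hs, hst⟩, rfl⟩

lemma runningMax_le (ht : 0 ≤ t) (h : ∀ s, 0 ≤ s → s ≤ t → f s ≤ c) : runningMax f t ≤ c :=
  csSup_le ⟨f 0, 0, ⟨le_rfl, ht⟩, rfl⟩ (by rintro _ ⟨s, hs, rfl⟩; exact h s hs.1 hs.2)

lemma runningMax_zero : runningMax f 0 = f 0 := by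
  simp [runningMax]

lemma runningMax_mono (hf : Continuous f) (hs : 0 ≤ s) (hst : s ≤ t) :
    runningMax f s ≤ runningMax f t :=
  runningMax_le hs fun _ h0 h1 => le_runningMax hf h0 (h1.trans hst)

lemma runningMax_le_add (hf : LipschitzWith 1 f) (hs : 0 ≤ s) (hst : s ≤ t) :
    runningMax f t ≤ runningMax f s + (t - s) := by
  refine runningMax_le (hs.trans hst) fun x h0 h1 => ?_
  rcases le_total x s with h | h
  · linarith [le_runningMax hf.continuous h0 h]
  · have h2 := hf.dist_le_mul x s
    rw [Real.dist_eq, Real.dist_eq, NNReal.coe_one, one_mul, abs_of_nonneg (sub_nonneg.2 h)] at h2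
    linarith [le_abs_self (f x - f s), le_runningMax hf.continuous hs le_rfl]

lemma lipschitzOnWith_runningMax (hf : LipschitzWith 1 f) :
    LipschitzOnWith 1 (runningMax f) (Ici 0) := by
  refine LipschitzOnWith.of_le_add_mul 1 fun x hx y hy => ?_
  rw [NNReal.coe_one, one_mul, Real.dist_eq]
  rcases le_total x y with h | h
  · linarith [runningMax_mono hf.continuous hx h, abs_nonneg (x - y)]
  · linarith [runningMax_le_add hf hy h, le_abs_self (x - y)]

/-- Below its record, a continuous function needs some time before it can set a new one. -/
lemma runningMax_eventually_eq (hf : Continuous f) (ht : 0 ≤ t) (hlt : f t < runningMax f t) :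
    ∀ᶠ s in 𝓝[>] t, runningMax f s = runningMax f t := by
  obtain ⟨ε, hε, hball⟩ := Metric.eventually_nhds_iff_ball.1
    (hf.continuousAt.eventually (gt_mem_nhds hlt))
  filter_upwards [Ioo_mem_nhdsGT (show t < t + ε by linarith)] with s hs
  refine le_antisymm (runningMax_le (ht.trans hs.1.le) fun x h0 h1 => ?_)
    (runningMax_mono hf ht hs.1.le)
  rcases le_total x t with h | h
  · exact le_runningMax hf h0 h
  · refine (hball x ?_).le
    rw [Metric.mem_ball, Real.dist_eq, abs_of_nonneg (sub_nonneg.2 h)]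
    linarith [hs.2]

lemma hasDerivAt_runningMax_mem {D : ℝ} (hf : LipschitzWith 1 f) (ht : 0 < t)
    (hD : HasDerivAt (runningMax f) D t) : D ∈ Icc 0 1 := by
  have hs := (hasDerivAt_iff_tendsto_slope.1 hD).mono_left
    (nhdsWithin_mono (s := Ioi t) t fun x hx => ne_of_gt hx)
  have hb : ∀ᶠ x in 𝓝[>] t, slope (runningMax f) t x ∈ Icc (0 : ℝ) 1 := by
    filter_upwards [self_mem_nhdsWithin] with x hx
    have hx' : 0 < x - t := sub_pos.2 hx
    rw [slope_def_field]
    constructor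
    · exact div_nonneg (sub_nonneg.2 (runningMax_mono hf.continuous ht.le (le_of_lt hx))) hx'.le
    · rw [div_le_one hx']
      linarith [runningMax_le_add hf ht.le (le_of_lt hx)]
  exact isClosed_Icc.mem_of_tendsto hs hb

lemma hasDerivAt_runningMax_eq_zero {D : ℝ} (hf : Continuous f) (ht : 0 ≤ t)
    (hlt : f t < runningMax f t) (hD : HasDerivAt (runningMax f) D t) : D = 0 := by
  have hs := (hasDerivAt_iff_tendsto_slope.1 hD).mono_left
    (nhdsWithin_mono (s := Ioi t) t fun x hx => ne_of_gt hx)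
  refine tendsto_nhds_unique hs (tendsto_const_nhds.congr' ?_)
  filter_upwards [runningMax_eventually_eq hf ht hlt] with x hx
  simp [slope_def_field, hx]

end runningMax

/-! ### Strict comparison under reparametrization -/

/-- Comparison of Prüfer angles: `f` is the time on the decreasing profile `v₀` at which the weight
is that of `v` at time `t`, and `f` has speed at most one. -/
lemma IsPruferAngle.lt_of_reparam {k μ : ℝ} (hμ : 0 ≤ μ) {v v₀ v₀' : ℝ → ℝ}
    (hv : Continuous v) (hpos : ∀ t, 0 < v t) (hv₀ : Continuous v₀) (hpos₀ : ∀ t, 0 < v₀ t)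
    {L L₀ : ℝ} (hL₀ : 0 < L₀) (hL : L₀ < L) {θ θ₀ : ℝ → ℝ} (h : IsPruferAngle k μ v L θ)
    (h₀ : IsPruferAngle k μ v₀ L₀ θ₀) (hd : ∀ t ∈ Ioo 0 L₀, HasDerivAt v₀ (v₀' t) t)
    (hd' : ∀ t ∈ Ioo 0 L₀, v₀' t ≤ 0) {f : ℝ → ℝ} (hf : LipschitzWith 1 f) (hf0 : f 0 = 0)
    (hfL : f L = L₀) (hfle : ∀ t, f t ≤ L₀)
    (heq : ∀ t ∈ Ioo 0 L, 0 ≤ f t → f t < L₀ → v t = v₀ (f t))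
    (hle : ∀ t ∈ Ioo 0 L, ∀ s ∈ Ico 0 L₀, f t < s → v₀ s ≤ v t) :
    θ 0 < θ₀ 0 := by
  have hL0 : 0 < L := hL₀.trans hL
  have hfc := hf.continuous
  set τ := runningMax f with hτ
  have hτlip : LipschitzOnWith 1 τ (Icc 0 L) :=
    (lipschitzOnWith_runningMax hf).mono fun t ht => ht.1
  have hτ0 : τ 0 = 0 := by rw [hτ, runningMax_zero, hf0]
  have hτle : ∀ t, 0 ≤ t → τ t ≤ L₀ := fun t ht => runningMax_le ht fun s _ _ => hfle s
  have hτnn : ∀ t, 0 ≤ t → 0 ≤ τ t := fun t ht => hτ0 ▸ runningMax_mono hfc le_rfl ht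
  have hτL : τ L = L₀ := le_antisymm (hτle L hL0.le) (hfL ▸ le_runningMax hfc hL0.le le_rfl)
  have hτmem : ∀ t, 0 ≤ t → τ t ∈ Icc 0 L₀ := fun t ht => ⟨hτnn t ht, hτle t ht⟩
  have hfield₀ := h₀.pruferField_pos hμ hv₀ hpos₀ hL₀.le hd hd'
  obtain ⟨K, hK⟩ := h₀.exists_lipschitzOnWith hv₀ hpos₀
  -- `f` may backtrack or become negative; its running maximum is monotone and stays in `[0, L₀]`,
  -- where `θ₀` is controlled.
  set ψ : ℝ → ℝ := fun t => θ₀ (τ t) with hψ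
  have hψlip : LipschitzOnWith (K * 1) ψ (Icc 0 L) :=
    hK.comp hτlip fun t ht => hτmem t ht.1
  have key : ∀ t ∈ Ioo 0 L, DifferentiableAt ℝ τ t →
      deriv ψ t ≤ pruferField k μ (v t) (ψ t) ∧
        (deriv ψ t = pruferField k μ (v t) (ψ t) → deriv τ t = 1) := by
    intro t ht hdt
    have hD := hdt.hasDerivAt
    set D := deriv τ t with hDdef
    have hψd : deriv ψ t = pruferField k μ (v₀ (τ t)) (ψ t) * D :=
      ((h₀.2 _ (hτmem t ht.1.le)).comp t hD).deriv
    have hDmem := hasDerivAt_runningMax_mem hf ht.1 hD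
    -- Where `τ` stalls, `ψ' = 0`, so positivity of the field suffices and rules out equality.
    have hstrict : D = 0 → 0 < pruferField k μ (v t) (ψ t) →
        deriv ψ t ≤ pruferField k μ (v t) (ψ t) ∧
          (deriv ψ t = pruferField k μ (v t) (ψ t) → D = 1) := fun h0 hp => by
      rw [hψd, h0, mul_zero]
      exact ⟨hp.le, fun h => absurd h hp.ne⟩
    have hfield := hfield₀ _ (hτmem t ht.1.le)
    -- Once `τ` has reached `L₀` it stalls, and `ψ = 0` makes the field `1 / v`.
    rcases (hτle t ht.1.le).eq_or_lt with hτt | hτt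
    · refine hstrict ?_ ?_
      · refine IsLocalMax.hasDerivAt_eq_zero ?_ hD
        filter_upwards [Ioi_mem_nhds ht.1] with x hx
        rw [hτt]
        exact hτle x (le_of_lt hx)
      · have hψ0 : ψ t = 0 := by
          simp only [hψ, hτt]
          exact h₀.1
        rw [hψ0, pruferField_of_sin_eq_zero Real.sin_zero]
        exact one_div_pos.2 (hpos t)
    · rcases (le_runningMax hfc ht.1.le le_rfl : f t ≤ τ t).eq_or_lt with hft | hft
      · have hvt : v t = v₀ (τ t) := by
          rw [show τ t = f t from hft.symm]
          exact heq t ht (hft ▸ hτnn t ht.1.le) (hft ▸ hτt)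
        rw [hψd, hvt]
        refine ⟨mul_le_of_le_one_right hfield.le hDmem.2, fun h1 => ?_⟩
        exact mul_left_cancel₀ hfield.ne' (h1.trans (mul_one _).symm)
      · refine hstrict (hasDerivAt_runningMax_eq_zero hfc ht.1.le hft hD) ?_
        have hvle := hle t ht _ ⟨hτnn t ht.1.le, hτt⟩ hft
        refine (mul_pos_iff_of_pos_left (hpos t)).1 ?_
        refine (mul_pos (hpos₀ (τ t)) hfield).trans_le ?_
        rw [mul_pruferField (hpos t), mul_pruferField (hpos₀ _)]
        have := hpos₀ (τ t)
        gcongr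
  have hτd : ∀ᵐ t ∂volume.restrict (Ioc 0 L), t ∈ Ioo 0 L ∧ DifferentiableAt ℝ τ t := by
    rw [← Measure.restrict_congr_set Ioo_ae_eq_Ioc, ae_restrict_iff' measurableSet_Ioo]
    have hτlip' := hτlip
    rw [← uIcc_of_le hL0.le] at hτlip'
    filter_upwards [hτlip'.absolutelyContinuousOnInterval.ae_differentiableAt] with t ht htm
    refine ⟨htm, ht ?_⟩
    rw [uIcc_of_le hL0.le]
    exact Ioo_subset_Icc_self htm
  rcases h.lt_or_ae_eq hv hpos hL0 hψlip (by simp only [hψ, hτL]; exact h₀.1)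
    (by filter_upwards [hτd] with t ht using (key t ht.1 ht.2).1) with hlt | hae
  · simpa only [hψ, hτ0] using hlt
  · exfalso
    -- Integrating `τ' = 1` would give `L₀ = L`.
    have h1 : ∀ᵐ t ∂volume.restrict (Ioc 0 L), deriv τ t = 1 := by
      filter_upwards [hτd, hae] with t ht hat using (key t ht.1 ht.2).2 hat
    rw [← uIcc_of_le hL0.le] at hτlip
    have h2 := hτlip.absolutelyContinuousOnInterval.integral_deriv_eq_sub
    rw [intervalIntegral.integral_of_le hL0.le, integral_congr_ae h1, hτL, hτ0] at h2
    simp [hL0.le] at h2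
    linarith

/-- Strict comparison of min-max eigenvalues: `f` is the time on the decreasing profile `v₀` at
which the weight is that of `v` at time `t`, and `f` has speed at most one. -/
lemma sInf_minMaxSet_lt_of_reparam (k : ℝ) {v v₀ v₀' : ℝ → ℝ}
    (hv : Continuous v) (hpos : ∀ t, 0 < v t) (hv₀ : Continuous v₀) (hpos₀ : ∀ t, 0 < v₀ t)
    {L L₀ : ℝ} (hL₀ : 0 < L₀) (hL : L₀ < L) (hd : ∀ t ∈ Ioo 0 L₀, HasDerivAt v₀ (v₀' t) t)
    (hd' : ∀ t ∈ Ioo 0 L₀, v₀' t ≤ 0) {f : ℝ → ℝ} (hf : LipschitzWith 1 f) (hf0 : f 0 = 0)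
    (hfL : f L = L₀) (hfle : ∀ t, f t ≤ L₀)
    (heq : ∀ t ∈ Ioo 0 L, 0 ≤ f t → f t < L₀ → v t = v₀ (f t))
    (hle : ∀ t ∈ Ioo 0 L, ∀ s ∈ Ico 0 L₀, f t < s → v₀ s ≤ v t) {n : ℕ} (hn : 1 ≤ n) :
    sInf (minMaxSet v L k n) < sInf (minMaxSet v₀ L₀ k n) := by
  have hL0 : 0 < L := hL₀.trans hL
  set μ := sInf (minMaxSet v₀ L₀ k n) with hμdef
  have hμ : 0 ≤ μ := Real.sInf_nonneg fun c hc => nonneg_of_mem_minMaxSet k hL₀.le hpos₀ hc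
  obtain ⟨θ₀, h₀⟩ := exists_isPruferAngle k μ hv₀ hpos₀ hL₀.le
  obtain ⟨θ, h⟩ := exists_isPruferAngle k μ hv hpos hL0.le
  -- The infimum need not be attained, so the node count is applied at `μ + ε / C`; returning to `μ`
  -- moves the angle by at most `ε`.
  have hθ₀ : θ₀ 0 ≤ -(n * Real.pi) := by
    obtain ⟨C, hC, hb⟩ := exists_pruferAngle_param_bound k μ hv₀ hpos₀ hL₀.le h₀
    refine le_of_forall_pos_le_add fun ε hε => ?_
    have hμ' : μ < μ + ε / C := by have := div_pos hε hC; linarith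
    obtain ⟨c, hc, hcμ⟩ := exists_lt_of_csInf_lt (minMaxSet_nonempty k hL₀ hv₀ hpos₀ hn) hμ'
    obtain ⟨W, hW, hWn, hlt⟩ := exists_subspace_of_mem_minMaxSet k hL₀ hv₀ hpos₀ hc hcμ
    obtain ⟨θ', h'⟩ := exists_isPruferAngle k (μ + ε / C) hv₀ hpos₀ hL₀.le
    have h1 := h'.le_of_subspace k hL₀ hv₀ hpos₀ hW hWn hlt
    have h2 := hb _ _ h'
    rw [add_sub_cancel_left, abs_of_pos (div_pos hε hC), mul_div_cancel₀ _ hC.ne'] at h2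
    linarith [(abs_le.1 h2).1]
  have hθ := (h.lt_of_reparam hμ hv hpos hv₀ hpos₀ hL₀ hL h₀ hd hd' hf hf0 hfL hfle heq
    hle).trans_le hθ₀
  obtain ⟨C, hC, hb⟩ := exists_pruferAngle_param_bound k μ hv hpos hL0.le h
  -- Lowering `μ` by `δ` raises the angle at `0` by at most the whole gap, so `n` nodal intervals
  -- remain.
  set δ := (-(n * Real.pi) - θ 0) / C with hδ
  have hδ0 : 0 < δ := div_pos (by linarith) hC
  obtain ⟨θ', h'⟩ := exists_isPruferAngle k (μ - δ) hv hpos hL0.le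
  have h2 := hb _ _ h'
  rw [sub_sub_cancel_left, abs_neg, abs_of_pos hδ0, hδ, mul_div_cancel₀ _ hC.ne'] at h2
  obtain ⟨W, hW, hWn, hlt⟩ := h'.exists_subspace hv hpos hL0
    (by linarith [(abs_le.1 h2).2]) (show μ - δ < μ by linarith)
  exact sInf_minMaxSet_lt k hL0 hv hpos hn hW hWn hlt

/-! ### Unit speed curves -/

lemma IsPiecewiseSmooth.continuousOn {γ : ℝ → ℝ × ℝ} {L : ℝ} (h : IsPiecewiseSmooth γ L) :
    ContinuousOn γ (Icc 0 L) := by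
  obtain ⟨m, τ, h0, hm, hlt, hs⟩ := h
  have key : ∀ i ≤ m, 0 ≤ τ i ∧ ContinuousOn γ (Icc 0 (τ i)) := by
    intro i
    induction i with
    | zero => intro _; rw [h0]; simp
    | succ i ih =>
      intro hi
      obtain ⟨h1, h2⟩ := ih (by omega)
      have h3 := (hlt i hi).le
      refine ⟨h1.trans h3, ?_⟩
      rw [← Icc_union_Icc_eq_Icc h1 h3]
      exact h2.union_of_isClosed (hs i hi).continuousOn isClosed_Icc isClosed_Icc
  exact hm ▸ (key m le_rfl).2

/-- A function with nonnegative derivative off the corners of a curve is monotone. -/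
lemma IsPiecewiseSmooth.monotoneOn {γ : ℝ → ℝ × ℝ} {L : ℝ} (h : IsPiecewiseSmooth γ L)
    {f f' : ℝ → ℝ} (hc : ContinuousOn f (Icc 0 L))
    (hd : ∀ t ∈ Ioo 0 L, DifferentiableAt ℝ γ t → HasDerivAt f (f' t) t ∧ 0 ≤ f' t) :
    MonotoneOn f (Icc 0 L) := by
  obtain ⟨m, τ, h0, hm, hlt, hs⟩ := h
  have hmono : ∀ i j, i ≤ j → j ≤ m → τ i ≤ τ j := by
    intro i j hij
    induction hij with
    | refl => exact fun _ => le_rfl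
    | step _ ih => exact fun hj => (ih (Nat.le_of_succ_le hj)).trans (hlt _ hj).le
  have hpiece : ∀ i < m, MonotoneOn f (Icc (τ i) (τ (i + 1))) := by
    intro i hi
    have hsub : Icc (τ i) (τ (i + 1)) ⊆ Icc 0 L := by
      rw [← h0, ← hm]
      exact Icc_subset_Icc (hmono 0 i (Nat.zero_le i) hi.le) (hmono (i + 1) m hi le_rfl)
    have hder : ∀ t ∈ Ioo (τ i) (τ (i + 1)), HasDerivAt f (f' t) t ∧ 0 ≤ f' t := by
      intro t ht
      refine hd t ⟨(hsub ⟨le_rfl, (hlt i hi).le⟩).1.trans_lt ht.1,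
        ht.2.trans_le (hsub ⟨(hlt i hi).le, le_rfl⟩).2⟩ ?_
      exact ((hs i hi).contDiffAt (Icc_mem_nhds ht.1 ht.2)).differentiableAt (by simp)
    refine monotoneOn_of_deriv_nonneg (convex_Icc _ _) (hc.mono hsub) ?_ ?_ <;>
      rw [interior_Icc]
    · exact fun t ht => (hder t ht).1.differentiableAt.differentiableWithinAt
    · intro t ht
      rw [(hder t ht).1.deriv]
      exact (hder t ht).2
  have key : ∀ i ≤ m, MonotoneOn f (Icc 0 (τ i)) := by
    intro i
    induction i with
    | zero => intro _; rw [h0]; simp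
    | succ i ih =>
      intro hi
      have h1 : 0 ≤ τ i := h0 ▸ hmono 0 i (Nat.zero_le i) (by omega)
      have h3 := (hlt i hi).le
      rw [← Icc_union_Icc_eq_Icc h1 h3]
      exact (ih (by omega)).union_right (hpiece i hi) (isGreatest_Icc h1) (isLeast_Icc h3)
  exact hm ▸ key m le_rfl

lemma IsArcLength.sq_add_eq_one {gyy : ℝ → ℝ} {α : ℝ → ℝ × ℝ} {L : ℝ}
    (hα : IsArcLength gyy α L) {t : ℝ} (ht : t ∈ Ioo 0 L) (hd : DifferentiableAt ℝ α t) :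
    (deriv α t).1 ^ 2 + gyy (α t).1 * (deriv α t).2 ^ 2 = 1 := by
  have h1 := hα t ht hd
  rw [metricLength, Real.sqrt_eq_one] at h1
  exact h1

section unitSpeed

variable {gyy : ℝ → ℝ} {α : ℝ → ℝ × ℝ} {L : ℝ}

lemma hasDerivAt_fst {t : ℝ} (hd : DifferentiableAt ℝ α t) :
    HasDerivAt (fun t => (α t).1) (deriv α t).1 t :=
  hd.hasDerivAt.fst

lemma hasDerivAt_snd {t : ℝ} (hd : DifferentiableAt ℝ α t) :
    HasDerivAt (fun t => (α t).2) (deriv α t).2 t :=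
  hd.hasDerivAt.snd

lemma IsArcLength.abs_deriv_fst_le (hg_pos : ∀ x, 0 < x → 0 < gyy x) (hα : IsArcLength gyy α L)
    {t : ℝ} (ht : t ∈ Ioo 0 L) (hx : 0 < (α t).1) (hd : DifferentiableAt ℝ α t) :
    |(deriv α t).1| ≤ 1 := by
  have h1 := hα.sq_add_eq_one ht hd
  have h2 := mul_nonneg (hg_pos _ hx).le (sq_nonneg (deriv α t).2)
  rw [← sq_le_one_iff_abs_le_one]
  linarith

lemma monotoneOn_fst_add (hs : IsPiecewiseSmooth α L) (hg_pos : ∀ x, 0 < x → 0 < gyy x)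
    (hα : IsArcLength gyy α L) (hx : ∀ t ∈ Ico 0 L, 0 < (α t).1) :
    MonotoneOn (fun t => (α t).1 + t) (Icc 0 L) := by
  refine hs.monotoneOn (f' := fun t => (deriv α t).1 + 1)
    (hs.continuousOn.fst.add continuousOn_id) fun t ht hd => ?_
  refine ⟨(hasDerivAt_fst hd).add (hasDerivAt_id t), ?_⟩
  linarith [(abs_le.1 (hα.abs_deriv_fst_le hg_pos ht (hx t (Ioo_subset_Ico_self ht)) hd)).1]

lemma monotoneOn_sub_fst (hs : IsPiecewiseSmooth α L) (hg_pos : ∀ x, 0 < x → 0 < gyy x)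
    (hα : IsArcLength gyy α L) (hx : ∀ t ∈ Ico 0 L, 0 < (α t).1) :
    MonotoneOn (fun t => t - (α t).1) (Icc 0 L) := by
  refine hs.monotoneOn (f' := fun t => 1 - (deriv α t).1)
    (continuousOn_id.sub hs.continuousOn.fst) fun t ht hd => ?_
  refine ⟨(hasDerivAt_id t).sub (hasDerivAt_fst hd), ?_⟩
  linarith [(abs_le.1 (hα.abs_deriv_fst_le hg_pos ht (hx t (Ioo_subset_Ico_self ht)) hd)).2]

lemma abs_fst_sub_le (hs : IsPiecewiseSmooth α L) (hg_pos : ∀ x, 0 < x → 0 < gyy x)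
    (hα : IsArcLength gyy α L) (hx : ∀ t ∈ Ico 0 L, 0 < (α t).1) {s t : ℝ} (hsm : s ∈ Icc 0 L)
    (htm : t ∈ Icc 0 L) : |(α s).1 - (α t).1| ≤ |s - t| := by
  wlog hst : s ≤ t generalizing s t
  · rw [abs_sub_comm, abs_sub_comm s]
    exact this htm hsm (le_of_not_ge hst)
  have h1 := monotoneOn_fst_add hs hg_pos hα hx hsm htm hst
  have h2 := monotoneOn_sub_fst hs hg_pos hα hx hsm htm hst
  simp only at h1 h2
  rw [abs_sub_comm s, abs_of_nonneg (sub_nonneg.2 hst), abs_le]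
  constructor <;> linarith

/-- A unit speed curve that covers the distance `r₁ - r₂` in the time `r₁ - r₂` is the segment. -/
lemma eqOn_segmentCurve (hs : IsPiecewiseSmooth α L) (hg_pos : ∀ x, 0 < x → 0 < gyy x)
    (hα : IsArcLength gyy α L) (hx : ∀ t ∈ Ico 0 L, 0 < (α t).1) (hL : 0 ≤ L) {r : ℝ}
    (h0 : α 0 = (r, 0)) (h1 : (α L).1 = r - L) : EqOn α (segmentCurve r) (Icc 0 L) := by
  have hm0 : (0 : ℝ) ∈ Icc 0 L := ⟨le_rfl, hL⟩
  -- `F + t` is nondecreasing and takes the same value `r` at both ends.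
  have hfst : ∀ t ∈ Icc 0 L, (α t).1 = r - t := by
    intro t ht
    have h2 := monotoneOn_fst_add hs hg_pos hα hx hm0 ht ht.1
    have h3 := monotoneOn_fst_add hs hg_pos hα hx ht ⟨hL, le_rfl⟩ ht.2
    simp only [h0, h1] at h2 h3
    linarith
  -- `F' = -1` uses up the unit speed, and `gyy > 0` then forces `G' = 0`.
  have hsnd' : ∀ t ∈ Ioo 0 L, DifferentiableAt ℝ α t → (deriv α t).2 = 0 := by
    intro t ht hd
    have hpos := hx t (Ioo_subset_Ico_self ht)
    have h2 : (deriv α t).1 = -1 := by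
      refine (hasDerivAt_fst hd).unique ?_
      refine ((hasDerivAt_id t).const_sub r).congr_of_eventuallyEq ?_
      filter_upwards [Icc_mem_nhds ht.1 ht.2] with s hs using hfst s hs
    have h3 := hα.sq_add_eq_one ht hd
    rw [h2] at h3
    have h4 : gyy (α t).1 * (deriv α t).2 ^ 2 = 0 := by linarith
    simpa [(hg_pos _ hpos).ne'] using h4
  have hup : MonotoneOn (fun t => (α t).2) (Icc 0 L) :=
    hs.monotoneOn (f' := fun t => (deriv α t).2) hs.continuousOn.snd
      fun t ht hd => ⟨hasDerivAt_snd hd, (hsnd' t ht hd).ge⟩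
  have hdown : MonotoneOn (fun t => -(α t).2) (Icc 0 L) :=
    hs.monotoneOn (f' := fun t => -(deriv α t).2) hs.continuousOn.snd.neg
      fun t ht hd => ⟨(hasDerivAt_snd hd).neg, by rw [hsnd' t ht hd, neg_zero]⟩
  intro t ht
  refine Prod.ext (hfst t ht) ?_
  change (α t).2 = 0
  have h2 := hup hm0 ht ht.1
  have h3 := hdown hm0 ht ht.1
  simp only [h0] at h2 h3
  exact le_antisymm (by linarith) h2

end unitSpeed

/-! ### The theorem -/

theorem lemma2p3
    (gyy V : ℝ → ℝ)
    (hg_smooth : ContDiffOn ℝ ∞ gyy (Ici 0))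
    (hg_nonneg : ∀ x, 0 ≤ x → 0 ≤ gyy x)
    (hg_pos : ∀ x, 0 < x → 0 < gyy x)
    (hV_smooth : ContDiffOn ℝ ∞ V (Ici 0))
    (hV_nonneg : ∀ x, 0 ≤ x → 0 ≤ V x)
    (hV_pos : ∀ x, 0 < x → 0 < V x)
    (hV_deriv : ∀ x, 0 < x → 0 < deriv V x)
    (r₁ r₂ : ℝ) (hr₂ : 0 ≤ r₂) (hr : r₂ < r₁)
    (hV_zero : V 0 = 0 → 0 < r₂)
    (L : ℝ) (hL : 0 < L)
    (α : ℝ → ℝ × ℝ)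
    (hα_smooth : IsPiecewiseSmooth α L)
    (hα_halfplane : ∀ t ∈ Ico 0 L, 0 < (α t).1)
    (hα_arc : IsArcLength gyy α L)
    (hα_start : α 0 = (r₁, 0))
    (hα_end : (α L).1 = r₂)
    (hα_ne : ¬ (L = r₁ - r₂ ∧ EqOn α (segmentCurve r₁) (Icc 0 L)))
    (k : ℝ) (hk : 0 ≤ k) (n : ℕ) (hn : 1 ≤ n) :
    minMaxEigenvalue V α L k n < minMaxEigenvalue V (segmentCurve r₁) (r₁ - r₂) k n := by
  have hL₀ : 0 < r₁ - r₂ := sub_pos.2 hr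
  have hVc := hV_smooth.continuousOn
  have hVr₂ : 0 < V r₂ := by
    rcases hr₂.eq_or_lt with h | h
    · rw [← h]
      exact lt_of_le_of_ne (hV_nonneg 0 le_rfl) fun h0 => (hV_zero h0.symm).ne h
    · exact hV_pos _ h
  have hVmono : StrictMonoOn V (Ici 0) :=
    strictMonoOn_of_deriv_pos (convex_Ici 0) hVc fun x hx => by
      rw [interior_Ici] at hx
      exact hV_deriv x hx
  have hFnn : ∀ t ∈ Icc 0 L, 0 ≤ (α t).1 ∧ 0 < V (α t).1 := fun t ht => by
    rcases ht.2.eq_or_lt with h | h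
    · rw [h, hα_end]
      exact ⟨hr₂, hVr₂⟩
    · have := hα_halfplane t ⟨ht.1, h⟩
      exact ⟨this.le, hV_pos _ this⟩
  have hlip := fun s t => abs_fst_sub_le (s := s) (t := t) hα_smooth hg_pos hα_arc hα_halfplane
  have hlen : r₁ - r₂ < L := by
    have h1 := hlip L 0 ⟨hL.le, le_rfl⟩ ⟨le_rfl, hL.le⟩
    rw [hα_end, hα_start, abs_sub_comm, sub_zero, abs_of_pos hL, abs_of_pos hL₀] at h1
    refine lt_of_le_of_ne h1 fun heq => hα_ne ⟨heq.symm, ?_⟩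
    exact eqOn_segmentCurve hα_smooth hg_pos hα_arc hα_halfplane hL.le hα_start
      (by rw [hα_end, ← heq]; ring)
  -- Freezing both curves outside their time intervals makes the weights continuous and positive on
  -- the whole line.
  set P : ℝ → ℝ := fun t => projIcc 0 L hL.le t with hP
  set P₀ : ℝ → ℝ := fun t => projIcc 0 (r₁ - r₂) hL₀.le t with hP₀
  have hPm : ∀ t, P t ∈ Icc 0 L := fun t => (projIcc 0 L hL.le t).2
  have hP₀m : ∀ t, P₀ t ∈ Icc 0 (r₁ - r₂) := fun t => (projIcc 0 (r₁ - r₂) hL₀.le t).2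
  have hPe : ∀ t ∈ Icc 0 L, P t = t := fun t ht => by simp only [hP, projIcc_of_mem hL.le ht]
  have hP₀e : ∀ t ∈ Icc 0 (r₁ - r₂), P₀ t = t := fun t ht => by
    simp only [hP₀, projIcc_of_mem hL₀.le ht]
  have hP₀c : Continuous P₀ := continuous_subtype_val.comp continuous_projIcc
  have hP₀r : ∀ t, r₂ ≤ r₁ - P₀ t := fun t => by linarith [(hP₀m t).2]
  have hFlip : LipschitzWith 1 fun t => (α (P t)).1 := LipschitzWith.of_dist_le_mul fun s t => by
    rw [NNReal.coe_one, one_mul, Real.dist_eq]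
    refine (hlip _ _ (hPm s) (hPm t)).trans ?_
    have := (LipschitzWith.projIcc hL.le).dist_le_mul s t
    rwa [NNReal.coe_one, one_mul] at this
  -- The cap is needed because `α` may pass below the level `r₂` before its final time.
  set f : ℝ → ℝ := fun t => min (r₁ - (α (P t)).1) (r₁ - r₂) with hf
  have hflip : LipschitzWith 1 f := by
    refine LipschitzWith.min_const (LipschitzWith.of_dist_le_mul fun s t => ?_) _
    rw [dist_sub_left]
    exact hFlip.dist_le_mul s t
  have h0L : (0 : ℝ) ∈ Icc 0 L := ⟨le_rfl, hL.le⟩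
  have hLL : L ∈ Icc 0 L := ⟨hL.le, le_rfl⟩
  rw [minMaxEigenvalue_eq V α hL.le k n (v := fun t => V (α (P t)).1)
      fun t ht => by simp only [hPe t ht],
    minMaxEigenvalue_eq V (segmentCurve r₁) hL₀.le k n (v := fun t => V (r₁ - P₀ t))
      fun t ht => by simp only [segmentCurve, hP₀e t ht]]
  have hVpos₀ : ∀ t, 0 < V (r₁ - P₀ t) := fun t => hVr₂.trans_le
    (hVmono.monotoneOn hr₂ (hr₂.trans (hP₀r t)) (hP₀r t))
  refine sInf_minMaxSet_lt_of_reparam k (v := fun t => V (α (P t)).1)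
    (v₀ := fun t => V (r₁ - P₀ t)) (v₀' := fun t => -deriv V (r₁ - t)) (f := f)
    (hVc.comp_continuous hFlip.continuous fun t => (hFnn _ (hPm t)).1)
    (fun t => (hFnn _ (hPm t)).2)
    (hVc.comp_continuous (continuous_const.sub hP₀c) fun t => hr₂.trans (hP₀r t)) hVpos₀
    hL₀ hlen (fun t ht => ?_) (fun t ht => ?_) hflip ?_ ?_ (fun t => min_le_right _ _)
    (fun t ht h0 h1 => ?_) (fun t ht s hs hfs => ?_) hn
  · have hx : 0 < r₁ - t := by linarith [ht.2]
    have hVd : HasDerivAt V (deriv V (r₁ - t)) (r₁ - t) :=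
      ((hV_smooth.contDiffAt (Ici_mem_nhds hx)).differentiableAt (by simp)).hasDerivAt
    refine (hVd.comp_const_sub r₁ t).congr_of_eventuallyEq ?_
    filter_upwards [Icc_mem_nhds ht.1 ht.2] with s hs
    rw [hP₀e s hs]
  · exact neg_nonpos.2 (hV_deriv _ (by linarith [ht.2])).le
  · simp [hf, hPe 0 h0L, hα_start, hr.le]
  · simp [hf, hPe L hLL, hα_end]
  · have h2 : f t = r₁ - (α (P t)).1 := by
      rcases min_choice (r₁ - (α (P t)).1) (r₁ - r₂) with h | h
      · exact h
      · exact absurd h1 (by rw [hf]; simp only [h]; exact lt_irrefl _)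
    rw [hP₀e _ ⟨h0, h1.le⟩, h2, sub_sub_cancel]
  · have h2 : r₁ - (α (P t)).1 < s := (min_lt_iff.1 hfs).resolve_right (not_lt.2 hs.2.le)
    simp only [hP₀e s (Ico_subset_Icc_self hs)]
    exact hVmono.monotoneOn (show (0 : ℝ) ≤ r₁ - s by linarith [hs.2])
      (hFnn _ (hPm t)).1 (by linarith)
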